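/- Let $a>0$, let $\nu\in\mathbb{C}$ with $\operatorname{Re}\nu>0$, $\nu\ne 1,2,\dots$, put $\nu_0=\nu^2-1/4$, and let $A=[a_{jk}]_{j,k=1,2}$ be a complex matrix with $\det A\neq 0$. Let $q$ be a complex-valued function on $(0,\infty)$ such that, for some $T>a$, $q(x)|x-a|^{\min(0,1-2\operatorname{Re}\nu)}\in L(0,T)$ and $q\in L(T,\infty)$. Consider the equation $$-y''+\Big(\frac{\nu_0}{(x-a)^2}+q(x)\Big)y=\lambda y,\qquad x>0. \tag{1}$$ Let $z^{\mu}=\exp(\mu(\ln|z|+i\arg z))$ with $\arg z\in(-\pi,\pi]$. For $j=1,2$ let $\mu_j=(-1)^j\nu+1/2$, let $c_{10},c_{20}\in\mathbb{C}$ be fixed with $c_{10}c_{20}=(2\nu)^{-1}$, and set $$c_{jk}=(-1)^kc_{j0}\Big(\prod_{s=1}^{k}\big((2s+\mu_j)(2s+\mu_j-1)-\nu_0\big)\Big)^{-1},\qquad C_j(x,\lambda)=(x-a)^{\mu_j}\sum_{k=0}^{\infty}c_{jk}\lambda^k(x-a)^{2k}.$$ Let $s_j(x,\lambda)$, $x\in[0,a)\cup(a,\infty)$,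 be the solutions of $$s_j(x,\lambda)=C_j(x,\lambda)+\int_a^x\big(C_1(t,\lambda)C_2(x,\lambda)-C_1(x,\lambda)C_2(t,\lambda)\big)q(t)s_j(t,\lambda)\,dt$$ (with absolutely convergent integral); they are solutions of (1). Put $\sigma_j(x,\lambda)=s_j(x,\lambda)$ for $0\le x<a$ and $\sigma_j(x,\lambda)=\sum_{k=1}^2a_{kj}s_k(x,\lambda)$ for $x>a$. A number $\lambda$ is called an eigenvalue of the boundary value problem $\mathcal{L}$ if there is a nontrivial function of the form $y(x)=\alpha_1\sigma_1(x,\lambda)+\alpha_2\sigma_2(x,\lambda)$ with constants $\alpha_1,\alpha_2\in\mathbb{C}$ such that $y(0)=0$ and $\lim_{x\to\infty}y(x)=0$. For $\rho\neq0$ with $\operatorname{Im}\rho\ge0$, let $e(x,\rho)$ be the function of the form $A_1(\rho)\sigma_1(x,\rho^2)+A_2(\rho)\sigma_2(x,\rho^2)$ with $\lim_{x\to\infty}e(x,\rho)\exp(-i\rho x)=1$ (the discontinuous Jost solution), and let $\Delta(\rho)=e(0,\rho)$. Theorem. $\mathcal{L}$ has no eigenvalues $\lambda>0$. Moreover, if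 $\lambda_0=\rho_0^2>0$ and $\Delta(\rho_0)=0$, then $\Delta(-\rho_0)\neq0$. -/

import Mathlib

open MeasureTheory Filter Topology

noncomputable section

/-- The data of the boundary value problem on the half-line for
`-y'' + ((ν ^ 2 - 1 / 4) / (x - a) ^ 2 + q) y = lam y`, `y 0 = 0`:
the singular point `a`, the parameter `ν`, the potential `q`, the transition matrix `A`
(`A k j` is the entry in row `k` and column `j`, with indices `0, 1`), and the leading
coefficients `c 0`, `c 1` of the two model solutions at the singular point. -/
structure SingularSL where
  a : ℝ
  ν : ℂ
  q : ℝ → ℂ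
  A : Matrix (Fin 2) (Fin 2) ℂ
  c : Fin 2 → ℂ

namespace SingularSL

/-- `ν₀ = ν² - 1/4`. -/
def ν₀ (P : SingularSL) : ℂ := P.ν ^ 2 - 1 / 4

/-- The class of potentials: `q |x - a| ^ min (0, 1 - 2 Re ν)` is in `L(0, T)` and `q` is in
`L(T, ∞)`, for some `T > a`. -/
def PotentialClass (P : SingularSL) : Prop :=
  ∃ T : ℝ, P.a < T ∧
    IntegrableOn
      (fun x : ℝ => P.q x * ((|x - P.a| ^ min 0 (1 - 2 * P.ν.re) : ℝ) : ℂ)) (Set.Ioo 0 T) ∧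
    IntegrableOn P.q (Set.Ioi T)

/-- The standing assumptions on the data. -/
structure Admissible (P : SingularSL) : Prop where
  a_pos : 0 < P.a
  re_ν_pos : 0 < P.ν.re
  ν_ne : ∀ n : ℕ, 1 ≤ n → P.ν ≠ n
  q_mem : P.PotentialClass
  c_mul : P.c 0 * P.c 1 = (2 * P.ν)⁻¹
  det_A : P.A.det ≠ 0

/-- The exponents `1/2 - ν` (index `0`) and `1/2 + ν` (index `1`). -/
def μ (P : SingularSL) (j : Fin 2) : ℂ := (-1) ^ ((j : ℕ) + 1) * P.ν + 1 / 2

/-- The coefficients `c_{jk}` of the model solutions. -/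
def coeff (P : SingularSL) (j : Fin 2) (k : ℕ) : ℂ :=
  (-1) ^ k * P.c j *
    (∏ s ∈ Finset.Icc 1 k,
      ((2 * (s : ℂ) + P.μ j) * (2 * (s : ℂ) + P.μ j - 1) - P.ν₀))⁻¹

/-- The model solutions `C_j(x, lam)`: Bessel-type solutions of the equation with `q = 0`. The
complex power is the one with `arg` in `(-π, π]`; for `lam = ρ ^ 2` the `k`-th term of the sum is
`c_{jk} (ρ (x - a)) ^ (2 k)`. -/
def C (P : SingularSL) (j : Fin 2) (lam : ℂ) (x : ℝ) : ℂ :=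
  ((x - P.a : ℝ) : ℂ) ^ P.μ j *
    ∑' k : ℕ, P.coeff j k * lam ^ k * ((x - P.a : ℝ) : ℂ) ^ (2 * k)

/-- The kernel `g(x, t, lam) = C_1(t) C_2(x) - C_1(x) C_2(t)`. -/
def g (P : SingularSL) (lam : ℂ) (x t : ℝ) : ℂ :=
  P.C 0 lam t * P.C 1 lam x - P.C 0 lam x * P.C 1 lam t

/-- The integral equation `s(x) = C_j(x) + ∫_a^x g(x, t) q(t) s(t) dt` on `[0, a) ∪ (a, ∞)`,
the integral being absolutely convergent. -/
def SolvesIntegralEq (P : SingularSL) (j : Fin 2) (lam : ℂ) (s : ℝ → ℂ) : Prop :=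
  ∀ x : ℝ, 0 ≤ x → x ≠ P.a →
    IntervalIntegrable (fun t => P.g lam x t * P.q t * s t) volume P.a x ∧
    s x = P.C j lam x + ∫ t in P.a..x, P.g lam x t * P.q t * s t

/-- `s_j(x, lam)`: the solution of the integral equation (only its values on
`[0, a) ∪ (a, ∞)` are meaningful). -/
def s (P : SingularSL) (j : Fin 2) (lam : ℂ) : ℝ → ℂ :=
  Classical.epsilon (P.SolvesIntegralEq j lam)

/-- `σ_j(x, lam)`, the fundamental system that encodes the matching conditions:
`s_j` to the left of `a` and `∑ k, a_{kj} s_k` to the right. -/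
def σ (P : SingularSL) (j : Fin 2) (lam : ℂ) (x : ℝ) : ℂ :=
  if x < P.a then P.s j lam x else ∑ k, P.A k j * P.s k lam x

/-- `y` has the form `∑ k, α k σ_k(x, lam)` on `[0, a) ∪ (a, ∞)`: the solutions of the equation
that satisfy the matching conditions at `a`. -/
def IsMatchedSolution (P : SingularSL) (lam : ℂ) (y : ℝ → ℂ) : Prop :=
  ∃ α : Fin 2 → ℂ, ∀ x : ℝ, 0 ≤ x → x ≠ P.a → y x = ∑ k, α k * P.σ k lam x

/-- `lam` is an eigenvalue: there is a nontrivial matched solution with `y 0 = 0` and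
`y x → 0` as `x → ∞`. -/
def IsEigenvalue (P : SingularSL) (lam : ℂ) : Prop :=
  ∃ y : ℝ → ℂ, P.IsMatchedSolution lam y ∧ (∃ x : ℝ, 0 ≤ x ∧ x ≠ P.a ∧ y x ≠ 0) ∧
    y 0 = 0 ∧ Tendsto y atTop (𝓝 0)

/-- The conditions that determine the discontinuous Jost solution for `ρ ≠ 0`, `0 ≤ Im ρ`. -/
def IsJost (P : SingularSL) (ρ : ℂ) (y : ℝ → ℂ) : Prop :=
  P.IsMatchedSolution (ρ ^ 2) y ∧
    Tendsto (fun x : ℝ => y x * Complex.exp (-(Complex.I * ρ * x))) atTop (𝓝 1)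

/-- The discontinuous Jost solution `e(x, ρ)`, for `ρ ≠ 0` and `0 ≤ Im ρ`. -/
def e (P : SingularSL) (ρ : ℂ) : ℝ → ℂ := Classical.epsilon (P.IsJost ρ)

/-- The characteristic function `Δ(ρ) = e(0, ρ)`. -/
def Δ (P : SingularSL) (ρ : ℂ) : ℂ := P.e ρ 0

end SingularSL

end

/-! For real `ρ ≠ 0` the potential, singular term included, is integrable near infinity. Every
matched solution at `ρ ^ 2` therefore behaves like `c exp (iρx) + d exp (-iρx)`, and `(c, d)`
depends on its two coefficients through an invertible matrix (`exists_asymptotics`). Such a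
combination tends to zero only for `c = d = 0`, so a matched solution vanishing at infinity is
trivial and no positive eigenvalue exists. The Jost solutions for `ρ` and `-ρ` correspond to `(1,
0)` and `(0, 1)`, hence span all matched solutions. If both vanished at `0`, so would `s_1` and
`s_2`, against `s_zero_ne_zero`.

The singularity at `a` is handled by variation of constants: writing `y = u C_0 + v C_1` turns the
integral equation into a linear system for `(u, v)` with coefficients `q C_i C_j`. The weight in the
potential class makes these integrable across `a`, so `(u, v)` is continuous there and determined by
its value at any point. The same device with plane waves in place of the `C_j` gives the
asymptotics. Both systems rest on one Gronwall estimate with the weight `exp (2 |∫ n|)`. -/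

/-! ### Gronwall estimate and linear Volterra equations with integrable coefficients -/

/-- The integrand is half the derivative of `± exp (2 |∫ n|)`. The gain of the factor `1 / 2` makes
the Volterra operator with kernel `n` a contraction in the norm weighted by this exponential. -/
theorem abs_integral_mul_exp_le {n : ℝ → ℝ} (hn : ∀ t, 0 ≤ n t) {a x : ℝ}
    (hint : IntervalIntegrable n volume a x) :
    |∫ t in a..x, n t * Real.exp (2 * |∫ r in a..t, n r|)| ≤
      Real.exp (2 * |∫ r in a..x, n r|) / 2 := by
  set h : ℝ → ℝ := fun t => ∫ r in a..t, n r with hh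
  have hsub : ∀ {u v : ℝ}, u ∈ Set.uIcc a x → v ∈ Set.uIcc a x →
      IntervalIntegrable n volume u v := fun hu hv =>
    hint.mono_set (Set.uIcc_subset_uIcc hu hv)
  have ha : a ∈ Set.uIcc a x := Set.left_mem_uIcc
  have hmono : MonotoneOn h (Set.uIcc a x) := by
    intro u hu v hv huv
    have h1 : h v - h u = ∫ r in u..v, n r :=
      intervalIntegral.integral_interval_sub_left (hsub ha hv) (hsub ha hu)
    have h2 : 0 ≤ ∫ r in u..v, n r :=
      intervalIntegral.integral_nonneg huv fun t _ => hn t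
    linarith
  have hderiv : ∀ᵐ t, t ∈ Set.uIcc a x → HasDerivAt h (n t) t := by
    filter_upwards [hint.ae_hasDerivAt_integral] with t ht hm using ht hm a ha
  have ha0 : h a = 0 := intervalIntegral.integral_same
  obtain ⟨ε, hε, hεh⟩ : ∃ ε : ℝ, (ε = 1 ∨ ε = -1) ∧ ∀ t ∈ Set.uIcc a x, |h t| = ε * h t := by
    rcases le_total a x with hax | hax
    · refine ⟨1, Or.inl rfl, fun t ht => ?_⟩
      have : h a ≤ h t := hmono ha ht (by rw [Set.uIcc_of_le hax] at ht; exact ht.1)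
      rw [abs_of_nonneg (by linarith), one_mul]
    · refine ⟨-1, Or.inr rfl, fun t ht => ?_⟩
      have : h t ≤ h a := hmono ht ha (by rw [Set.uIcc_of_ge hax] at ht; exact ht.2)
      rw [abs_of_nonpos (by linarith), neg_one_mul]
  set f : ℝ → ℝ := fun t => ε * Real.exp (2 * (ε * h t)) with hf
  have hfmono : MonotoneOn f (Set.uIcc a x) := by
    intro u hu v hv huv
    have := hmono hu hv huv
    rcases hε with rfl | rfl <;> simp only [hf, one_mul, neg_mul] <;> gcongr
  have hfd : ∀ᵐ t, t ∈ Set.uIcc a x →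
      deriv f t = 2 * (n t * Real.exp (2 * |h t|)) := by
    filter_upwards [hderiv] with t ht hm
    have h1 := ((((ht hm).const_mul ε).const_mul 2).exp).const_mul ε
    rw [h1.deriv, hεh t hm]
    rcases hε with rfl | rfl <;> ring
  have hI : ∫ t in a..x, deriv f t = 2 * ∫ t in a..x, n t * Real.exp (2 * |h t|) := by
    rw [← intervalIntegral.integral_const_mul]
    apply intervalIntegral.integral_congr_ae
    filter_upwards [hfd] with t ht hm using ht (Set.uIoc_subset_uIcc hm)
  -- For a monotone function the integral of the derivative lies between `0` and the increment; this
  -- inequality suffices, so absolute continuity of `f` is not needed.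
  have hmem := hfmono.intervalIntegral_deriv_mem_uIcc
  rw [hI] at hmem
  have hx := hεh x Set.right_mem_uIcc
  have hpos := Real.exp_pos (2 * |h x|)
  have h1 : 1 ≤ Real.exp (2 * |h x|) := Real.one_le_exp (by positivity)
  have hb : |f x - f a| ≤ Real.exp (2 * |h x|) := by
    simp only [hf, ha0, mul_zero, Real.exp_zero, mul_one, ← hx]
    rcases hε with rfl | rfl <;> rw [abs_le] <;> constructor <;> linarith
  have h2 : |2 * ∫ t in a..x, n t * Real.exp (2 * |h t|)| ≤ |f x - f a| := by
    have := Set.abs_sub_left_of_mem_uIcc hmem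
    simpa using this
  rw [abs_mul, abs_two] at h2
  linarith

/-- At a maximum point `y` of `f / W`, with value `M`, the hypothesis gives `M W ≤ c + M W / 2`; as
`W ≥ 1`, this forces `M ≤ 2 c`. No order between `a` and `x` is assumed, so the bound works in both
directions. -/
theorem le_exp_of_le_add_abs_integral {n f : ℝ → ℝ} (hn : ∀ t, 0 ≤ n t) {a x c : ℝ}
    (hint : IntervalIntegrable n volume a x) (hfc : ContinuousOn f (Set.uIcc a x))
    (hf0 : ∀ y ∈ Set.uIcc a x, 0 ≤ f y)
    (hf : ∀ y ∈ Set.uIcc a x, f y ≤ c + |∫ t in a..y, n t * f t|) :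
    f x ≤ 2 * c * Real.exp (2 * |∫ t in a..x, n t|) := by
  set W : ℝ → ℝ := fun t => Real.exp (2 * |∫ r in a..t, n r|) with hW
  have hWc : ContinuousOn W (Set.uIcc a x) := by
    have : ContinuousOn (fun t => ∫ r in a..t, n r) (Set.uIcc a x) :=
      intervalIntegral.continuousOn_primitive_interval' hint Set.left_mem_uIcc
    exact ((this.abs).const_smul (2 : ℝ)).rexp
  have hW0 : ∀ t, 0 < W t := fun t => Real.exp_pos _
  have hW1 : ∀ t, 1 ≤ W t := fun t => Real.one_le_exp (by positivity)
  obtain ⟨y, hy, hmax⟩ := isCompact_uIcc.exists_isMaxOn ⟨a, Set.left_mem_uIcc⟩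
    (hfc.div hWc fun t _ => (hW0 t).ne')
  set M := f y / W y with hM
  have hfM : ∀ t ∈ Set.uIcc a x, f t ≤ M * W t := fun t ht =>
    (div_le_iff₀ (hW0 t)).1 (hmax ht)
  have hc : 0 ≤ c := by
    have := hf a Set.left_mem_uIcc
    rw [intervalIntegral.integral_same, abs_zero, add_zero] at this
    exact (hf0 a Set.left_mem_uIcc).trans this
  have hM0 : 0 ≤ M := div_nonneg (hf0 y hy) (hW0 y).le
  have hss : Set.uIcc a y ⊆ Set.uIcc a x := Set.uIcc_subset_uIcc Set.left_mem_uIcc hy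
  have hint' := hint.mono_set hss
  have key : |∫ t in a..y, n t * f t| ≤ M * (W y / 2) := by
    have h1 : |∫ t in a..y, n t * f t| ≤ |∫ t in a..y, M * (n t * W t)| := by
      rw [intervalIntegral.abs_intervalIntegral_eq, intervalIntegral.abs_intervalIntegral_eq]
      rw [abs_of_nonneg, abs_of_nonneg]
      · refine setIntegral_mono_on ?_ ?_ measurableSet_uIoc fun t ht => ?_
        · exact (hint'.mul_continuousOn (hfc.mono hss)).def'
        · exact ((hint'.mul_continuousOn (hWc.mono hss)).const_mul M).def'
        · have := hfM t (hss (Set.uIoc_subset_uIcc ht))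
          have := mul_le_mul_of_nonneg_left this (hn t)
          linarith
      · exact setIntegral_nonneg measurableSet_uIoc fun t _ =>
          mul_nonneg hM0 (mul_nonneg (hn t) (hW0 t).le)
      · exact setIntegral_nonneg measurableSet_uIoc fun t ht =>
          mul_nonneg (hn t) (hf0 t (hss (Set.uIoc_subset_uIcc ht)))
    refine h1.trans ?_
    rw [intervalIntegral.integral_const_mul, abs_mul, abs_of_nonneg hM0]
    exact mul_le_mul_of_nonneg_left (abs_integral_mul_exp_le hn hint') hM0
  have h2 : M * W y ≤ c * W y + M * (W y / 2) := by
    have h3 := hf y hy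
    have : M * W y = f y := div_mul_cancel₀ _ (hW0 y).ne'
    have : c ≤ c * W y := le_mul_of_one_le_right hc (hW1 y)
    linarith
  have h3 : M ≤ 2 * c := by
    have : M * W y ≤ (2 * c) * W y := by linarith
    exact le_of_mul_le_mul_right this (hW0 y)
  exact (hfM x Set.right_mem_uIcc).trans (mul_le_mul_of_nonneg_right h3 (hW0 x).le)

theorem eq_zero_of_eq_integral_clm {E : Type*} [NormedAddCommGroup E] [NormedSpace ℂ E]
    {N : ℝ → E →L[ℂ] E} {w : ℝ → E} {a x : ℝ} (hN : IntervalIntegrable N volume a x)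
    (hw : ContinuousOn w (Set.uIcc a x))
    (h : ∀ y ∈ Set.uIcc a x, w y = ∫ t in a..y, N t (w t)) : w x = 0 := by
  have := le_exp_of_le_add_abs_integral (n := fun t => ‖N t‖) (f := fun t => ‖w t‖) (c := 0)
    (fun t => norm_nonneg _) hN.norm hw.norm (fun y _ => norm_nonneg _) (fun y hy => by
      have hs := Set.uIcc_subset_uIcc Set.left_mem_uIcc hy
      rw [zero_add]
      conv_lhs => rw [h y hy]
      exact intervalIntegral.norm_integral_le_abs_of_norm_le
        (Eventually.of_forall fun t => (N t).le_opNorm (w t))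
        ((hN.mono_set hs).norm.mul_continuousOn (hw.mono hs).norm))
  simpa using this

theorem intervalIntegrable_clm_apply {E : Type*} [NormedAddCommGroup E] [NormedSpace ℂ E]
    {N : ℝ → E →L[ℂ] E} {w : ℝ → E} {u v : ℝ} (hN : IntervalIntegrable N volume u v)
    (hw : Continuous w) : IntervalIntegrable (fun t => N t (w t)) volume u v := by
  rw [intervalIntegrable_iff]
  obtain ⟨B, hB⟩ := isCompact_uIcc.exists_bound_of_continuousOn (hw.continuousOn (s := Set.uIcc u v))
  refine Integrable.mono' (hN.norm.mul_const B).def' ?_ ?_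
  · exact (ContinuousLinearMap.apply ℂ E).flip.aestronglyMeasurable_comp₂
      hN.def'.aestronglyMeasurable hw.aestronglyMeasurable
  · refine (ae_restrict_iff' measurableSet_uIoc).2 (Eventually.of_forall fun t ht => ?_)
    exact (N t).le_opNorm_of_le (hB t (Set.uIoc_subset_uIcc ht))

theorem exists_continuous_eq_add_integral {E : Type*} [NormedAddCommGroup E] [NormedSpace ℂ E]
    [CompleteSpace E] {N : ℝ → E →L[ℂ] E} (hN : ∀ u v, IntervalIntegrable N volume u v)
    (a : ℝ) (β : E) :
    ∃ w : ℝ → E, Continuous w ∧ ∀ x, w x = β + ∫ t in a..x, N t (w t) := by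
  set n : ℝ → ℝ := fun t => ‖N t‖ with hn
  have hni : ∀ u v, IntervalIntegrable n volume u v := fun u v => (hN u v).norm
  set W : ℝ → ℝ := fun t => Real.exp (2 * |∫ r in a..t, n r|) with hW
  have hWc : Continuous W :=
    Real.continuous_exp.comp (((intervalIntegral.continuous_primitive hni a).abs).const_mul 2)
  have hW0 : ∀ t, 0 < W t := fun t => Real.exp_pos _
  have hW1 : ∀ t, 1 ≤ W t := fun t => Real.one_le_exp (by positivity)
  have hap : ∀ (w : ℝ → E), Continuous w → ∀ u v,
      IntervalIntegrable (fun t => N t (w t)) volume u v := fun w hw u v =>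
    intervalIntegrable_clm_apply (hN u v) hw
  have hbd : ∀ (w : ℝ → E) (B : ℝ), (∀ t, ‖w t‖ ≤ B) → 0 ≤ B → ∀ x,
      ‖∫ t in a..x, N t (W t • w t)‖ ≤ B * (W x / 2) := by
    intro w B hB hB0 x
    have h1 : ‖∫ t in a..x, N t (W t • w t)‖ ≤ |∫ t in a..x, B * (n t * W t)| := by
      refine intervalIntegral.norm_integral_le_abs_of_norm_le (Eventually.of_forall fun t => ?_)
        (((hni a x).mul_continuousOn hWc.continuousOn).const_mul B)
      refine ((N t).le_opNorm _).trans ?_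
      rw [norm_smul, Real.norm_of_nonneg (hW0 t).le]
      have := mul_le_mul_of_nonneg_left (hB t) (mul_nonneg (norm_nonneg (N t)) (hW0 t).le)
      linarith
    refine h1.trans ?_
    rw [intervalIntegral.integral_const_mul, abs_mul, abs_of_nonneg hB0]
    exact mul_le_mul_of_nonneg_left
      (abs_integral_mul_exp_le (fun t => norm_nonneg (N t)) (hni a x)) hB0
  have hcont : ∀ f : BoundedContinuousFunction ℝ E,
      Continuous fun x => (W x)⁻¹ • (β + ∫ t in a..x, N t (W t • f t)) := fun f =>
    (hWc.inv₀ fun t => (hW0 t).ne').smul (continuous_const.add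
      (intervalIntegral.continuous_primitive (hap _ (hWc.smul f.continuous)) a))
  -- The Picard map for `w = W f`. Dividing by the weight keeps `f` bounded on the whole line and
  -- makes the Lipschitz constant `1 / 2`.
  let T : BoundedContinuousFunction ℝ E → BoundedContinuousFunction ℝ E := fun f =>
    BoundedContinuousFunction.ofNormedAddCommGroup
      (fun x => (W x)⁻¹ • (β + ∫ t in a..x, N t (W t • f t))) (hcont f) (‖β‖ + ‖f‖ / 2) (by
        intro x
        rw [norm_smul, norm_inv, Real.norm_of_nonneg (hW0 x).le, inv_mul_le_iff₀ (hW0 x)]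
        refine (norm_add_le _ _).trans ?_
        have h1 := hbd f ‖f‖ f.norm_coe_le_norm (norm_nonneg _) x
        have h2 := le_mul_of_one_le_left (norm_nonneg β) (hW1 x)
        linarith)
  have hT : ContractingWith (1 / 2) T := by
    refine ⟨by rw [← NNReal.coe_lt_coe]; norm_num, LipschitzWith.of_dist_le_mul fun f g => ?_⟩
    refine (BoundedContinuousFunction.dist_le (by positivity)).2 fun x => ?_
    have h0 : T f x - T g x = (W x)⁻¹ • ∫ t in a..x, N t (W t • (f - g) t) := by
      have : ∫ t in a..x, N t (W t • (f - g) t) =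
          (∫ t in a..x, N t (W t • f t)) - ∫ t in a..x, N t (W t • g t) := by
        refine Eq.trans ?_ (intervalIntegral.integral_sub (hap _ (hWc.smul f.continuous) _ _)
          (hap _ (hWc.smul g.continuous) _ _))
        congr 1; ext t
        simp [smul_sub]
      rw [this]
      simp only [T, BoundedContinuousFunction.coe_ofNormedAddCommGroup]
      rw [← smul_sub]; congr 1; abel
    rw [dist_eq_norm, h0, norm_smul, norm_inv, Real.norm_of_nonneg (hW0 x).le,
      inv_mul_le_iff₀ (hW0 x)]
    have := hbd (f - g) ‖f - g‖ (f - g).norm_coe_le_norm (norm_nonneg _) x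
    rw [dist_eq_norm]
    refine this.trans (le_of_eq ?_)
    push_cast; ring
  have hfix := hT.fixedPoint_isFixedPt
  set f := hT.fixedPoint T
  refine ⟨fun x => W x • f x, hWc.smul f.continuous, fun x => ?_⟩
  have h1 : f x = (W x)⁻¹ • (β + ∫ t in a..x, N t (W t • f t)) :=
    (DFunLike.congr_fun hfix x).symm
  simp only
  conv_lhs => rw [h1]
  rw [smul_inv_smul₀ (hW0 x).ne']

/-! ### Integration by parts for primitives of integrable functions -/

theorem IntervalIntegrable.exists_absolutelyContinuousOnInterval_primitive {f : ℝ → ℂ} {a b : ℝ}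
    (hf : IntervalIntegrable f volume a b) :
    ∃ F : ℝ → ℂ, AbsolutelyContinuousOnInterval F a b ∧
      (∀ x ∈ Set.uIcc a b, F x = ∫ t in a..x, f t) ∧
      ∀ᵐ x, x ∈ Set.uIcc a b → HasDerivAt F (f x) x := by
  have hre : IntervalIntegrable (fun t => (f t).re) volume a b := ⟨hf.1.re, hf.2.re⟩
  have him : IntervalIntegrable (fun t => (f t).im) volume a b := ⟨hf.1.im, hf.2.im⟩
  have hconst : ∀ c : ℂ, AbsolutelyContinuousOnInterval (fun _ : ℝ => c) a b := fun c =>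
    (contDiff_const.contDiffOn).absolutelyContinuousOnInterval
  have h1 := (hre.absolutelyContinuousOnInterval_intervalIntegral Set.left_mem_uIcc).smul
    (hconst 1)
  have h2 := (him.absolutelyContinuousOnInterval_intervalIntegral Set.left_mem_uIcc).smul
    (hconst Complex.I)
  refine ⟨_, h1.add h2, fun x hx => ?_, ?_⟩
  · have hs : IntervalIntegrable f volume a x :=
      hf.mono_set (Set.uIcc_subset_uIcc Set.left_mem_uIcc hx)
    have e1 : ∫ t in a..x, (f t).re = (∫ t in a..x, f t).re :=
      Complex.reCLM.intervalIntegral_comp_comm hs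
    have e2 : ∫ t in a..x, (f t).im = (∫ t in a..x, f t).im :=
      Complex.imCLM.intervalIntegral_comp_comm hs
    simp only [Pi.add_apply, Pi.smul_apply', e1, e2, Complex.real_smul, mul_one]
    exact Complex.re_add_im _
  · filter_upwards [hre.ae_hasDerivAt_integral, him.ae_hasDerivAt_integral] with x h3 h4 hx
    have := ((h3 hx a Set.left_mem_uIcc).smul_const (1 : ℂ)).add
      ((h4 hx a Set.left_mem_uIcc).smul_const Complex.I)
    convert! this using 1
    simp [Complex.re_add_im]

/-- Since `f` is only integrable, `u` is differentiable only almost everywhere. But `G u` minus the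
primitive of the right-hand integrand is absolutely continuous with derivative zero almost
everywhere, hence constant. -/
theorem integral_deriv_mul_add_mul {G G' f u : ℝ → ℂ} {a b : ℝ}
    (hG : ∀ x ∈ Set.uIcc a b, HasDerivAt G (G' x) x) (hG' : ContinuousOn G' (Set.uIcc a b))
    (hf : IntervalIntegrable f volume a b)
    (hu : ∀ x ∈ Set.uIcc a b, u x = u a + ∫ t in a..x, f t) :
    G b * u b - G a * u a = ∫ t in a..b, (G' t * u t + G t * f t) := by
  have hGc : ContinuousOn G (Set.uIcc a b) := fun x hx => (hG x hx).continuousAt.continuousWithinAt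
  have hGac : AbsolutelyContinuousOnInterval G a b := by
    obtain ⟨K, hK⟩ := isCompact_uIcc.exists_bound_of_continuousOn hG'
    have hK0 : 0 ≤ K := (norm_nonneg _).trans (hK a Set.left_mem_uIcc)
    have : LipschitzOnWith ⟨K, hK0⟩ G (Set.uIcc a b) :=
      (convex_uIcc a b).lipschitzOnWith_of_nnnorm_hasDerivWithin_le
        (fun x hx => (hG x hx).hasDerivWithinAt) fun x hx => hK x hx
    exact this.absolutelyContinuousOnInterval
  obtain ⟨F, hFac, hF, hFd⟩ := hf.exists_absolutelyContinuousOnInterval_primitive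
  have huF : ∀ x ∈ Set.uIcc a b, u x = u a + F x := fun x hx => by rw [hF x hx, hu x hx]
  have hconst : AbsolutelyContinuousOnInterval (fun _ : ℝ => u a) a b :=
    (contDiff_const.contDiffOn).absolutelyContinuousOnInterval
  have huac := hconst.add hFac
  have hint : IntervalIntegrable (fun t => G' t * (u a + F t) + G t * f t) volume a b :=
    ((hG'.mul huac.continuousOn).intervalIntegrable).add (hf.continuousOn_mul hGc)
  obtain ⟨P, hPac, hP, hPd⟩ := hint.exists_absolutelyContinuousOnInterval_primitive
  have hac := (hGac.smul huac).sub hPac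
  obtain ⟨k, hk⟩ := hac.const_of_ae_hasDerivAt_zero (by
    filter_upwards [hFd, hPd] with x h1 h2 hx
    have h3 := ((hG x hx).mul ((h1 hx).const_add (u a))).sub (h2 hx)
    convert! h3 using 1
    ring)
  have hka : G a * (u a + F a) - P a = k := hk a Set.left_mem_uIcc
  have hkb : G b * (u a + F b) - P b = k := hk b Set.right_mem_uIcc
  have hF0 : F a = 0 := by rw [hF a Set.left_mem_uIcc, intervalIntegral.integral_same]
  have hP0 : P a = 0 := by rw [hP a Set.left_mem_uIcc, intervalIntegral.integral_same]
  rw [hF0, hP0, add_zero, sub_zero] at hka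
  have hI : ∫ t in a..b, (G' t * u t + G t * f t) = P b := by
    rw [hP b Set.right_mem_uIcc]
    exact intervalIntegral.integral_congr fun t ht => by simp only [huF t ht]
  rw [hI, huF b Set.right_mem_uIcc, hka, ← hkb]
  ring

/-! ### Everywhere convergent power series -/

theorem summable_norm_succ_mul {c : ℕ → ℂ} (hc : ∀ r : ℝ, Summable fun k => ‖c k‖ * r ^ k)
    (r : ℝ) : Summable fun k : ℕ => ‖(k + 1 : ℂ) * c (k + 1)‖ * r ^ k := by
  -- Doubling the radius absorbs the factor `k + 1 ≤ 2 ^ (k + 1)`; adding `1` makes the base at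
  -- least `1`, so the exponent can be raised.
  have h1 : Summable fun k : ℕ => ‖c (k + 1)‖ * (2 * (|r| + 1)) ^ (k + 1) :=
    (summable_nat_add_iff 1).2 (hc (2 * (|r| + 1)))
  refine Summable.of_norm_bounded h1 fun k => ?_
  rw [norm_mul, norm_norm, norm_mul, norm_pow, Real.norm_eq_abs]
  have hk : ‖(k + 1 : ℂ)‖ ≤ 2 ^ (k + 1) := by
    have : (k + 1 : ℂ) = ((k + 1 : ℕ) : ℂ) := by push_cast; rfl
    rw [this, Complex.norm_natCast]
    exact_mod_cast (Nat.lt_two_pow_self).le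
  have hr : |r| ^ k ≤ (|r| + 1) ^ (k + 1) :=
    (pow_le_pow_left₀ (abs_nonneg r) (by linarith) k).trans
      (pow_le_pow_right₀ (by linarith [abs_nonneg r]) k.le_succ)
  rw [mul_pow]
  calc ‖(k + 1 : ℂ)‖ * ‖c (k + 1)‖ * |r| ^ k
      ≤ 2 ^ (k + 1) * ‖c (k + 1)‖ * (|r| + 1) ^ (k + 1) := by gcongr
    _ = ‖c (k + 1)‖ * (2 ^ (k + 1) * (|r| + 1) ^ (k + 1)) := by ring

theorem hasDerivAt_tsum_pow {c : ℕ → ℂ} (hc : ∀ r : ℝ, Summable fun k => ‖c k‖ * r ^ k) (z : ℂ) :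
    HasDerivAt (fun z => ∑' k, c k * z ^ k) (∑' k : ℕ, ((k + 1 : ℂ) * c (k + 1)) * z ^ k) z := by
  set R : ℝ := ‖z‖ + 1
  have hsum := summable_norm_succ_mul hc R
  have hu : Summable fun k : ℕ => ‖(k : ℂ) * c k‖ * R ^ (k - 1) := by
    rw [← summable_nat_add_iff 1]
    simpa using hsum
  have hd := hasDerivAt_tsum_of_isPreconnected (g := fun k z => c k * z ^ k)
    (g' := fun k z => c k * (k * z ^ (k - 1))) (y₀ := 0) (y := z) hu Metric.isOpen_ball
    (convex_ball (0 : ℂ) R).isPreconnected (fun k y _ => (hasDerivAt_pow k y).const_mul (c k))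
    (fun k y hy => by
      rw [norm_mul, norm_mul, norm_mul, norm_pow, ← mul_assoc, mul_comm ‖c k‖]
      have : ‖y‖ ≤ R := (mem_ball_zero_iff.1 hy).le
      gcongr)
    (by simp only [Metric.mem_ball, dist_self, R]; positivity)
    (summable_of_ne_finset_zero (s := {0}) fun k hk => by
      simp only [Finset.mem_singleton] at hk; simp [hk])
    (by simp [R])
  convert! hd using 1
  have hs : Summable fun k : ℕ => c k * (k * z ^ (k - 1)) := by
    refine Summable.of_norm_bounded hu fun k => ?_
    rw [norm_mul, norm_mul, norm_mul, norm_pow, ← mul_assoc, mul_comm ‖c k‖]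
    have : ‖z‖ ≤ R := by simp [R]
    gcongr
  rw [hs.tsum_eq_zero_add]
  simp only [Nat.cast_zero, zero_mul, mul_zero, zero_add, Nat.add_sub_cancel, Nat.cast_add,
    Nat.cast_one]
  exact tsum_congr fun k => by ring

noncomputable section

/-- The sum of the power series with coefficients `c`. -/
def powerSum (c : ℕ → ℂ) (z : ℂ) : ℂ := ∑' k, c k * z ^ k

/-- The coefficients of the derivative of the power series with coefficients `c`. -/
def derivCoeff (c : ℕ → ℂ) (k : ℕ) : ℂ := (k + 1 : ℂ) * c (k + 1)

/-- The power series with coefficients `c` converges absolutely everywhere. -/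
def EntireCoeff (c : ℕ → ℂ) : Prop := ∀ r : ℝ, Summable fun k => ‖c k‖ * r ^ k

theorem EntireCoeff.derivCoeff {c : ℕ → ℂ} (hc : EntireCoeff c) : EntireCoeff (derivCoeff c) :=
  summable_norm_succ_mul hc

theorem EntireCoeff.hasDerivAt {c : ℕ → ℂ} (hc : EntireCoeff c) (z : ℂ) :
    HasDerivAt (powerSum c) (powerSum (_root_.derivCoeff c) z) z :=
  hasDerivAt_tsum_pow hc z

theorem EntireCoeff.hasSum {c : ℕ → ℂ} (hc : EntireCoeff c) (z : ℂ) :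
    HasSum (fun k => c k * z ^ k) (powerSum c z) :=
  (Summable.of_norm (by simpa using hc ‖z‖)).hasSum

theorem EntireCoeff.continuous {c : ℕ → ℂ} (hc : EntireCoeff c) : Continuous (powerSum c) :=
  continuous_iff_continuousAt.2 fun z => (hc.hasDerivAt z).continuousAt

theorem powerSum_zero (c : ℕ → ℂ) : powerSum c 0 = c 0 := by
  rw [powerSum, tsum_eq_single 0 fun k hk => by simp [hk]]
  simp

/-- Comparison of coefficients of `z ^ k`. This is the Bessel equation in the variable `z = lam (x -
a) ^ 2`; it is used with `κ = μ_j - 1 / 2 = ± ν`. -/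
theorem powerSum_bessel_equation {c : ℕ → ℂ} (hc : EntireCoeff c) {κ : ℂ}
    (hrec : ∀ k : ℕ, 4 * (k + 1 : ℂ) * (k + 1 + κ) * c (k + 1) = -c k) (z : ℂ) :
    4 * z * powerSum (derivCoeff (derivCoeff c)) z + 4 * (1 + κ) * powerSum (derivCoeff c) z
      + powerSum c z = 0 := by
  have h2 : HasSum (fun k : ℕ => (k : ℂ) * derivCoeff c k * z ^ k)
      (z * powerSum (derivCoeff (derivCoeff c)) z) := by
    rw [← hasSum_nat_add_iff' 1]
    convert! (hc.derivCoeff.derivCoeff.hasSum z).mul_left z using 1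
    · ext k
      simp only [derivCoeff]
      push_cast
      ring
    · simp
  have h := ((h2.mul_left 4).add ((hc.derivCoeff.hasSum z).mul_left (4 * (1 + κ)))).add (hc.hasSum z)
  have h0 : (fun k : ℕ => 4 * ((k : ℂ) * derivCoeff c k * z ^ k) +
      4 * (1 + κ) * (derivCoeff c k * z ^ k) + c k * z ^ k) = fun _ => 0 := by
    ext k
    have := hrec k
    simp only [derivCoeff]
    linear_combination z ^ k * this
  rw [h0] at h
  have := h.unique hasSum_zero
  linear_combination this

/-! ### The model solutions at the singular point -/

theorem cpow_sub_one_mul {X : ℂ} (hX : X ≠ 0) (r : ℂ) : X ^ (r - 1) * X = X ^ r := by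
  rw [Complex.cpow_sub _ _ hX, Complex.cpow_one, div_mul_cancel₀ _ hX]

theorem hasDerivAt_ofReal_sub_cpow {a x : ℝ} (hx : x ≠ a) (r : ℂ) :
    HasDerivAt (fun y : ℝ => ((y - a : ℝ) : ℂ) ^ r) (r * ((x - a : ℝ) : ℂ) ^ (r - 1)) x := by
  rcases eq_or_ne r 0 with rfl | hr
  · simpa using hasDerivAt_const x (1 : ℂ)
  · exact (hasDerivAt_ofReal_cpow_const (sub_ne_zero.2 hx) hr).comp_sub_const x a

namespace SingularSL

variable {P : SingularSL}

theorem Admissible.ν_ne_zero (hP : P.Admissible) : P.ν ≠ 0 := fun h => by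
  have := hP.re_ν_pos
  simp [h] at this

theorem sq_μ_sub_half (P : SingularSL) (j : Fin 2) : (P.μ j - 1 / 2) ^ 2 = P.ν ^ 2 := by
  fin_cases j <;> simp [μ]

theorem μ_add (P : SingularSL) : P.μ 0 + P.μ 1 = 1 := by
  simp [μ]; ring

/-- For the exponent with `-ν` this is the exclusion of positive integers; for `+ν` the real part is
positive. -/
theorem Admissible.coeff_denom_ne_zero (hP : P.Admissible) (j : Fin 2) (k : ℕ) :
    (k + 1 : ℂ) + (P.μ j - 1 / 2) ≠ 0 := by
  intro h
  fin_cases j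
  · refine hP.ν_ne (k + 1) (by omega) ?_
    simp [μ] at h
    push_cast
    linear_combination -h
  · have := congrArg Complex.re h
    simp [μ] at this
    have h2 := hP.re_ν_pos
    have h3 : (0 : ℝ) ≤ k := Nat.cast_nonneg k
    linarith

theorem Admissible.coeff_succ (hP : P.Admissible) (j : Fin 2) (k : ℕ) :
    4 * (k + 1 : ℂ) * (k + 1 + (P.μ j - 1 / 2)) * P.coeff j (k + 1) = -P.coeff j k := by
  have hne := hP.coeff_denom_ne_zero j k
  have hk : (k + 1 : ℂ) ≠ 0 := by exact_mod_cast k.succ_ne_zero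
  have hfac : (2 * ((k + 1 : ℕ) : ℂ) + P.μ j) * (2 * ((k + 1 : ℕ) : ℂ) + P.μ j - 1) - P.ν₀ =
      4 * (k + 1 : ℂ) * (k + 1 + (P.μ j - 1 / 2)) := by
    have := P.sq_μ_sub_half j
    simp only [ν₀]
    push_cast
    linear_combination this
  have hne' : 4 * (k + 1 : ℂ) * (k + 1 + (P.μ j - 1 / 2)) ≠ 0 :=
    mul_ne_zero (mul_ne_zero (by norm_num) hk) hne
  simp only [coeff]
  rw [Finset.prod_Icc_succ_top (by omega), hfac, mul_inv, pow_succ]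
  set D := 4 * (k + 1 : ℂ) * (k + 1 + (P.μ j - 1 / 2))
  linear_combination -((-1) ^ k * P.c j * (∏ s ∈ Finset.Icc 1 k,
      ((2 * (s : ℂ) + P.μ j) * (2 * (s : ℂ) + P.μ j - 1) - P.ν₀))⁻¹) * mul_inv_cancel₀ hne'

theorem coeff_zero (P : SingularSL) (j : Fin 2) : P.coeff j 0 = P.c j := by simp [coeff]

theorem Admissible.entireCoeff (hP : P.Admissible) (j : Fin 2) : EntireCoeff (P.coeff j) := by
  intro r
  set κ := P.μ j - 1 / 2 with hκ
  refine summable_of_ratio_norm_eventually_le (r := 1 / 2) (by norm_num) ?_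
  filter_upwards [eventually_ge_atTop ⌈‖κ‖⌉₊, eventually_ge_atTop ⌈|r|⌉₊] with k h1 h2
  have h1' : ‖κ‖ ≤ k := Nat.ceil_le.1 h1
  have h2' : |r| ≤ k := Nat.ceil_le.1 h2
  have hrec := congrArg norm (hP.coeff_succ j k)
  rw [← hκ, norm_neg, norm_mul, norm_mul, norm_mul] at hrec
  have e1 : ‖(k + 1 : ℂ)‖ = k + 1 := by
    have : (k + 1 : ℂ) = ((k + 1 : ℕ) : ℂ) := by push_cast; rfl
    rw [this, Complex.norm_natCast]; push_cast; rfl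
  have e2 : 1 ≤ ‖(k + 1 : ℂ) + κ‖ := by
    have := norm_sub_le_norm_add (k + 1 : ℂ) κ
    rw [e1] at this; linarith
  rw [e1, show ‖(4 : ℂ)‖ = 4 by simp] at hrec
  simp only [norm_mul, norm_norm, norm_pow, Real.norm_eq_abs r, pow_succ]
  have h3 : 2 * |r| * ‖P.coeff j (k + 1)‖ ≤ ‖P.coeff j k‖ := by
    rw [← hrec]
    refine mul_le_mul_of_nonneg_right ?_ (norm_nonneg _)
    have : (0 : ℝ) ≤ k := Nat.cast_nonneg k
    nlinarith
  have := mul_le_mul_of_nonneg_right h3 (pow_nonneg (abs_nonneg r) k)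
  linarith

/-- The entire factor `∑ k, c_{jk} z ^ k` of the model solution `C_j`. -/
def φ (P : SingularSL) (j : Fin 2) : ℂ → ℂ := powerSum (P.coeff j)

/-- The derivative of `φ`. -/
def φ' (P : SingularSL) (j : Fin 2) : ℂ → ℂ := powerSum (derivCoeff (P.coeff j))

/-- The second derivative of `φ`. -/
def φ'' (P : SingularSL) (j : Fin 2) : ℂ → ℂ := powerSum (derivCoeff (derivCoeff (P.coeff j)))

theorem Admissible.hasDerivAt_φ (hP : P.Admissible) (j : Fin 2) (z : ℂ) :
    HasDerivAt (P.φ j) (P.φ' j z) z := (hP.entireCoeff j).hasDerivAt z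

theorem Admissible.hasDerivAt_φ' (hP : P.Admissible) (j : Fin 2) (z : ℂ) :
    HasDerivAt (P.φ' j) (P.φ'' j z) z := (hP.entireCoeff j).derivCoeff.hasDerivAt z

theorem Admissible.φ_equation (hP : P.Admissible) (j : Fin 2) (z : ℂ) :
    4 * z * P.φ'' j z + (4 * P.μ j + 2) * P.φ' j z + P.φ j z = 0 := by
  have := powerSum_bessel_equation (hP.entireCoeff j) (hP.coeff_succ j) z
  simp only [φ, φ', φ'']
  linear_combination this

theorem C_eq (P : SingularSL) (j : Fin 2) (lam : ℂ) (x : ℝ) :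
    P.C j lam x = ((x - P.a : ℝ) : ℂ) ^ P.μ j * P.φ j (lam * ((x - P.a : ℝ) : ℂ) ^ 2) := by
  simp only [C, φ, powerSum]
  congr 1
  exact tsum_congr fun k => by rw [mul_pow, ← pow_mul, mul_assoc]

/-- The derivative of the model solution `C_j` in `x`. -/
def dC (P : SingularSL) (j : Fin 2) (lam : ℂ) (x : ℝ) : ℂ :=
  ((x - P.a : ℝ) : ℂ) ^ (P.μ j - 1) *
    (P.μ j * P.φ j (lam * ((x - P.a : ℝ) : ℂ) ^ 2) +
      2 * (lam * ((x - P.a : ℝ) : ℂ) ^ 2) * P.φ' j (lam * ((x - P.a : ℝ) : ℂ) ^ 2))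

theorem hasDerivAt_mul_ofReal_sub_sq (lam : ℂ) (a x : ℝ) :
    HasDerivAt (fun y : ℝ => lam * ((y - a : ℝ) : ℂ) ^ 2) (2 * lam * ((x - a : ℝ) : ℂ)) x := by
  have h : HasDerivAt (fun y : ℝ => ((y - a : ℝ) : ℂ)) 1 x := by
    simpa using ((hasDerivAt_id x).sub_const a).ofReal_comp
  convert! (h.pow 2).const_mul lam using 1
  simp; ring

theorem Admissible.hasDerivAt_C (hP : P.Admissible) (j : Fin 2) (lam : ℂ) {x : ℝ}
    (hx : x ≠ P.a) : HasDerivAt (P.C j lam) (P.dC j lam x) x := by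
  have hX : ((x - P.a : ℝ) : ℂ) ≠ 0 := by exact_mod_cast sub_ne_zero.2 hx
  have hz := hasDerivAt_mul_ofReal_sub_sq lam P.a x
  have h := (hasDerivAt_ofReal_sub_cpow hx (P.μ j)).mul ((hP.hasDerivAt_φ j _).comp x hz)
  have hC : P.C j lam = fun y => ((y - P.a : ℝ) : ℂ) ^ P.μ j *
      (P.φ j ∘ fun y : ℝ => lam * ((y - P.a : ℝ) : ℂ) ^ 2) y := funext fun y => P.C_eq j lam y
  rw [hC]
  convert! h using 1
  have e : ((x - P.a : ℝ) : ℂ) ^ P.μ j = ((x - P.a : ℝ) : ℂ) ^ (P.μ j - 1) * ((x - P.a : ℝ) : ℂ) := by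
    rw [cpow_sub_one_mul hX]
  simp only [dC, Function.comp, e]
  ring

/-- The equation for `φ` together with `μ_j (μ_j - 1) = ν₀` shows that `C_j` solves the equation
with `q = 0`. -/
theorem Admissible.hasDerivAt_dC (hP : P.Admissible) (j : Fin 2) (lam : ℂ) {x : ℝ}
    (hx : x ≠ P.a) :
    HasDerivAt (P.dC j lam) ((P.ν₀ / ((x - P.a : ℝ) : ℂ) ^ 2 - lam) * P.C j lam x) x := by
  have hX : ((x - P.a : ℝ) : ℂ) ≠ 0 := by exact_mod_cast sub_ne_zero.2 hx
  have hz := hasDerivAt_mul_ofReal_sub_sq lam P.a x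
  have h := (hasDerivAt_ofReal_sub_cpow hx (P.μ j - 1)).mul
    ((((hP.hasDerivAt_φ j _).comp x hz).const_mul (P.μ j)).add
      ((hz.const_mul 2).mul ((hP.hasDerivAt_φ' j _).comp x hz)))
  refine h.congr_deriv ?_
  set X : ℂ := ((x - P.a : ℝ) : ℂ)
  have e1 : X ^ (P.μ j - 1) = X ^ (P.μ j - 1 - 1) * X := by
    rw [cpow_sub_one_mul hX]
  have e2 : X ^ P.μ j = X ^ (P.μ j - 1 - 1) * X ^ 2 := by
    rw [pow_two, ← mul_assoc, ← e1, cpow_sub_one_mul hX]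
  have hode := hP.φ_equation j (lam * X ^ 2)
  have hμ := P.sq_μ_sub_half j
  rw [C_eq, e2, e1]
  simp only [Function.comp, ν₀, Pi.mul_apply, Pi.add_apply]
  have e3 : ((P.ν ^ 2 - 1 / 4) / X ^ 2 - lam) * (X ^ (P.μ j - 1 - 1) * X ^ 2 * P.φ j (lam * X ^ 2)) =
      X ^ (P.μ j - 1 - 1) * ((P.ν ^ 2 - 1 / 4) - lam * X ^ 2) * P.φ j (lam * X ^ 2) := by
    field_simp
  rw [e3]
  linear_combination X ^ (P.μ j - 1 - 1) * (lam * X ^ 2) * hode +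
    X ^ (P.μ j - 1 - 1) * P.φ j (lam * X ^ 2) * hμ

/-- Stated for the entire factors, so that one constant serves both sides of `a`: the derivative
vanishes by the two equations, and the value at `z = 0` is `c_0 c_1 (μ_1 - μ_0) = 2 ν c_0 c_1 = 1`.
-/
theorem Admissible.φ_wronskian (hP : P.Admissible) (z : ℂ) :
    P.φ 0 z * (P.μ 1 * P.φ 1 z + 2 * z * P.φ' 1 z) -
      (P.μ 0 * P.φ 0 z + 2 * z * P.φ' 0 z) * P.φ 1 z = 1 := by
  set w : ℂ → ℂ := fun z => P.φ 0 z * (P.μ 1 * P.φ 1 z + 2 * z * P.φ' 1 z) -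
      (P.μ 0 * P.φ 0 z + 2 * z * P.φ' 0 z) * P.φ 1 z
  have hw : ∀ z, HasDerivAt w 0 z := by
    intro z
    have hid : HasDerivAt (fun z : ℂ => 2 * z) 2 z := by
      simpa using (hasDerivAt_id z).const_mul (2 : ℂ)
    have hd : ∀ j, HasDerivAt (fun z => P.μ j * P.φ j z + 2 * z * P.φ' j z)
        (P.μ j * P.φ' j z + (2 * P.φ' j z + 2 * z * P.φ'' j z)) z := fun j =>
      ((hP.hasDerivAt_φ j z).const_mul (P.μ j)).add (hid.mul (hP.hasDerivAt_φ' j z))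
    refine (((hP.hasDerivAt_φ 0 z).mul (hd 1)).sub ((hd 0).mul (hP.hasDerivAt_φ 1 z))).congr_deriv ?_
    have h0 := hP.φ_equation 0 z
    have h1 := hP.φ_equation 1 z
    linear_combination P.φ 0 z / 2 * h1 - P.φ 1 z / 2 * h0 +
      (P.φ' 0 z * P.φ 1 z - P.φ 0 z * P.φ' 1 z) * P.μ_add
  have hconst := is_const_of_deriv_eq_zero (fun z => (hw z).differentiableAt)
    (fun z => (hw z).deriv) z 0
  change w z = 1
  rw [hconst]
  simp only [w, φ, powerSum_zero, coeff_zero]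
  have h := hP.c_mul
  have hν := hP.ν_ne_zero
  have : P.c 0 * P.c 1 * (2 * P.ν) = 1 := by
    rw [h]; field_simp
  simp [μ]
  linear_combination this

theorem Admissible.wronskian (hP : P.Admissible) (lam : ℂ) {x : ℝ} (hx : x ≠ P.a) :
    P.C 0 lam x * P.dC 1 lam x - P.dC 0 lam x * P.C 1 lam x = 1 := by
  have hX : ((x - P.a : ℝ) : ℂ) ≠ 0 := by exact_mod_cast sub_ne_zero.2 hx
  have h := hP.φ_wronskian (lam * ((x - P.a : ℝ) : ℂ) ^ 2)
  rw [C_eq, C_eq]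
  simp only [dC]
  set X : ℂ := ((x - P.a : ℝ) : ℂ)
  have e1 : X ^ P.μ 0 * X ^ (P.μ 1 - 1) = 1 := by
    rw [← Complex.cpow_add _ _ hX, show P.μ 0 + (P.μ 1 - 1) = 0 by linear_combination P.μ_add,
      Complex.cpow_zero]
  have e2 : X ^ (P.μ 0 - 1) * X ^ P.μ 1 = 1 := by
    rw [← Complex.cpow_add _ _ hX, show P.μ 0 - 1 + P.μ 1 = 0 by linear_combination P.μ_add,
      Complex.cpow_zero]
  linear_combination h + (P.φ 0 (lam * X ^ 2) * (P.μ 1 * P.φ 1 (lam * X ^ 2) +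
    2 * (lam * X ^ 2) * P.φ' 1 (lam * X ^ 2))) * e1 - ((P.μ 0 * P.φ 0 (lam * X ^ 2) +
    2 * (lam * X ^ 2) * P.φ' 0 (lam * X ^ 2)) * P.φ 1 (lam * X ^ 2)) * e2

theorem Admissible.continuousAt_C (hP : P.Admissible) (j : Fin 2) (lam : ℂ) {x : ℝ}
    (hx : x ≠ P.a) : ContinuousAt (P.C j lam) x := (hP.hasDerivAt_C j lam hx).continuousAt

theorem Admissible.measurable_C (hP : P.Admissible) (j : Fin 2) (lam : ℂ) :
    Measurable (P.C j lam) := by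
  have hX : Measurable fun x : ℝ => ((x - P.a : ℝ) : ℂ) := by fun_prop
  have hφ : Measurable (P.φ j) := (hP.entireCoeff j).continuous.measurable
  have : P.C j lam = fun x : ℝ => ((x - P.a : ℝ) : ℂ) ^ P.μ j *
      P.φ j (lam * ((x - P.a : ℝ) : ℂ) ^ 2) := funext fun x => P.C_eq j lam x
  rw [this]
  exact (hX.pow_const _).mul (hφ.comp ((hX.pow_const 2).const_mul lam))

/-- The product is `(x - a) ^ (μ_i + μ_j)` times a locally bounded factor, and the real part of the
exponent is `1 - 2 Re ν`, `1` or `1 + 2 Re ν`. This is where the weight of the potential class comes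
from. -/
theorem Admissible.exists_norm_C_mul_C_le (hP : P.Admissible) (i j : Fin 2) (lam : ℂ) (R : ℝ) :
    ∃ K : ℝ, ∀ x : ℝ, x ≠ P.a → |x - P.a| ≤ R →
      ‖P.C i lam x * P.C j lam x‖ ≤ K * |x - P.a| ^ min 0 (1 - 2 * P.ν.re) := by
  set m := min 0 (1 - 2 * P.ν.re) with hm
  have hcont : Continuous fun x : ℝ => P.φ i (lam * ((x - P.a : ℝ) : ℂ) ^ 2) *
      P.φ j (lam * ((x - P.a : ℝ) : ℂ) ^ 2) := by
    have h1 := (hP.entireCoeff i).continuous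
    have h2 := (hP.entireCoeff j).continuous
    have h3 : Continuous fun x : ℝ => lam * ((x - P.a : ℝ) : ℂ) ^ 2 := by fun_prop
    exact (h1.comp h3).mul (h2.comp h3)
  obtain ⟨B, hB⟩ := (isCompact_Icc (a := P.a - R) (b := P.a + R)).exists_bound_of_continuousOn
    hcont.continuousOn
  set r := P.μ i + P.μ j with hr
  have hmr : m ≤ r.re := by
    have h0 := hP.re_ν_pos
    have h1 : m ≤ 0 := min_le_left _ _
    have h2 : m ≤ 1 - 2 * P.ν.re := min_le_right _ _
    have : r.re = 1 - 2 * P.ν.re ∨ r.re = 1 ∨ r.re = 1 + 2 * P.ν.re := by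
      fin_cases i <;> fin_cases j <;> simp [hr, μ] <;> grind
    rcases this with h | h | h <;> linarith
  refine ⟨R ^ (r.re - m) * Real.exp (Real.pi * |r.im|) * B, fun x hx hxR => ?_⟩
  have hX : ((x - P.a : ℝ) : ℂ) ≠ 0 := by exact_mod_cast sub_ne_zero.2 hx
  have habs : 0 < |x - P.a| := abs_pos.2 (sub_ne_zero.2 hx)
  have hBx := hB x (by rw [abs_le] at hxR; constructor <;> linarith)
  have h1 : ‖((x - P.a : ℝ) : ℂ) ^ r‖ ≤
      R ^ (r.re - m) * |x - P.a| ^ m * Real.exp (Real.pi * |r.im|) := by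
    rw [Complex.norm_cpow_of_ne_zero hX, Complex.norm_real, Real.norm_eq_abs, div_eq_mul_inv,
      ← Real.exp_neg]
    have e : |x - P.a| ^ r.re = |x - P.a| ^ (r.re - m) * |x - P.a| ^ m := by
      rw [← Real.rpow_add habs, sub_add_cancel]
    rw [e]
    have h3 : |x - P.a| ^ (r.re - m) ≤ R ^ (r.re - m) :=
      Real.rpow_le_rpow habs.le hxR (by linarith)
    -- The imaginary part of the exponent contributes only a bounded factor, also to the left of
    -- `a`, where the argument is `π`.
    have h4 : -(Complex.arg ((x - P.a : ℝ) : ℂ) * r.im) ≤ Real.pi * |r.im| := by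
      refine (neg_le_abs _).trans ?_
      rw [abs_mul]
      exact mul_le_mul_of_nonneg_right (Complex.abs_arg_le_pi _) (abs_nonneg _)
    have h5 := Real.rpow_nonneg habs.le m
    have h6 := Real.rpow_nonneg ((abs_nonneg _).trans hxR) (r.re - m)
    have h7 := mul_nonneg h6 h5
    gcongr
  have e : P.C i lam x * P.C j lam x = ((x - P.a : ℝ) : ℂ) ^ r *
      (P.φ i (lam * ((x - P.a : ℝ) : ℂ) ^ 2) * P.φ j (lam * ((x - P.a : ℝ) : ℂ) ^ 2)) := by
    rw [C_eq, C_eq, hr, Complex.cpow_add _ _ hX]; ring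
  rw [e, norm_mul]
  calc _ ≤ R ^ (r.re - m) * |x - P.a| ^ m * Real.exp (Real.pi * |r.im|) * B :=
        mul_le_mul h1 hBx (norm_nonneg _) ((norm_nonneg _).trans h1)
    _ = _ := by ring

theorem Admissible.intervalIntegrable_q_mul_C_mul_C (hP : P.Admissible) (i j : Fin 2) (lam : ℂ)
    {u v : ℝ} (hu : 0 ≤ u) (hv : 0 ≤ v) :
    IntervalIntegrable (fun t => P.q t * (P.C i lam t * P.C j lam t)) volume u v := by
  obtain ⟨T, hT, h1, h2⟩ := hP.q_mem
  have ha := hP.a_pos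
  have hmeas : Measurable fun t => P.C i lam t * P.C j lam t :=
    (hP.measurable_C i lam).mul (hP.measurable_C j lam)
  have hae : ∀ᵐ t : ℝ, t ≠ P.a := by simp [ae_iff, measure_singleton]
  have hI1 : IntegrableOn (fun t => P.q t * (P.C i lam t * P.C j lam t)) (Set.Ioo 0 T) := by
    obtain ⟨K, hK⟩ := hP.exists_norm_C_mul_C_le i j lam T
    set wt : ℝ → ℂ := fun x => ((|x - P.a| ^ min 0 (1 - 2 * P.ν.re) : ℝ) : ℂ) with hwt
    have hwtm : Measurable wt := by simp only [hwt]; fun_prop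
    have hb := h1.mul_bdd (c := K) (g := fun t => (wt t)⁻¹ * (P.C i lam t * P.C j lam t))
      ((hwtm.inv.mul hmeas).aestronglyMeasurable) (by
        rw [ae_restrict_iff' measurableSet_Ioo]
        filter_upwards [hae] with t ht htT
        have hpos : 0 < |t - P.a| ^ min 0 (1 - 2 * P.ν.re) :=
          Real.rpow_pos_of_pos (abs_pos.2 (sub_ne_zero.2 ht)) _
        change ‖(wt t)⁻¹ * (P.C i lam t * P.C j lam t)‖ ≤ K
        rw [norm_mul, norm_inv, hwt, Complex.norm_real, Real.norm_of_nonneg hpos.le,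
          inv_mul_le_iff₀ hpos, mul_comm _ K]
        refine hK t ht ?_
        rw [abs_le]
        constructor <;> linarith [htT.1, htT.2])
    refine hb.congr ?_
    rw [EventuallyEq, ae_restrict_iff' measurableSet_Ioo]
    filter_upwards [hae] with t ht _
    have hpos : wt t ≠ 0 := by
      simp only [hwt]
      exact_mod_cast (Real.rpow_pos_of_pos (abs_pos.2 (sub_ne_zero.2 ht)) _).ne'
    change P.q t * wt t * _ = _
    field_simp
  have hI2 : ∀ X, IntegrableOn (fun t => P.q t * (P.C i lam t * P.C j lam t)) (Set.Icc T X) := by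
    intro X
    have hq : IntegrableOn P.q (Set.Icc T X) :=
      (integrableOn_Icc_iff_integrableOn_Ioc).2 (h2.mono_set fun t ht => ht.1)
    refine hq.mul_continuousOn (fun t ht => ?_) isCompact_Icc
    have : t ≠ P.a := (hT.trans_le ht.1).ne'
    exact ((hP.continuousAt_C i lam this).mul (hP.continuousAt_C j lam this)).continuousWithinAt
  rw [intervalIntegrable_iff]
  refine (hI1.union (hI2 (max u v))).mono_set fun t ht => ?_
  have h3 : 0 < t := (le_min hu hv).trans_lt ht.1
  rcases lt_or_ge t T with h | h
  · exact Or.inl ⟨h3, h⟩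
  · exact Or.inr ⟨h, ht.2⟩

/-! ### Variation of constants: the amplitude system -/

/-- The product `q C_i C_j`, cut off to the half-line. -/
def qCC (P : SingularSL) (lam : ℂ) (i j : Fin 2) : ℝ → ℂ :=
  (Set.Ioi 0).indicator fun t => P.q t * (P.C i lam t * P.C j lam t)

/-- The coefficient of the linear system `w' = N w` for the amplitudes `w = (u, v)` of the
representation `y = u C_0 + v C_1` of the solutions. -/
def amplitudeSystem (P : SingularSL) (lam : ℂ) (t : ℝ) : (ℂ × ℂ) →L[ℂ] (ℂ × ℂ) :=
  P.qCC lam 0 1 t • (-(ContinuousLinearMap.inl ℂ ℂ ℂ).comp (ContinuousLinearMap.fst ℂ ℂ ℂ) +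
    (ContinuousLinearMap.inr ℂ ℂ ℂ).comp (ContinuousLinearMap.snd ℂ ℂ ℂ)) +
  P.qCC lam 1 1 t • (-(ContinuousLinearMap.inl ℂ ℂ ℂ).comp (ContinuousLinearMap.snd ℂ ℂ ℂ)) +
  P.qCC lam 0 0 t • (ContinuousLinearMap.inr ℂ ℂ ℂ).comp (ContinuousLinearMap.fst ℂ ℂ ℂ)

/-- The function `u C_0 + v C_1` with amplitudes `w = (u, v)`. -/
def ofAmplitude (P : SingularSL) (lam : ℂ) (w : ℝ → ℂ × ℂ) (t : ℝ) : ℂ :=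
  (w t).1 * P.C 0 lam t + (w t).2 * P.C 1 lam t

theorem amplitudeSystem_apply (lam : ℂ) {t : ℝ} (ht : 0 < t) (w : ℝ → ℂ × ℂ) :
    P.amplitudeSystem lam t (w t) = (-(P.C 1 lam t * P.q t * P.ofAmplitude lam w t),
      P.C 0 lam t * P.q t * P.ofAmplitude lam w t) := by
  simp only [amplitudeSystem, qCC, Set.indicator_of_mem (Set.mem_Ioi.2 ht), ofAmplitude]
  ext <;> simp <;> ring

theorem Admissible.intervalIntegrable_amplitudeSystem (hP : P.Admissible) (lam : ℂ) (u v : ℝ) :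
    IntervalIntegrable (P.amplitudeSystem lam) volume u v := by
  have h : ∀ i j, IntervalIntegrable (P.qCC lam i j) volume u v := by
    intro i j
    rw [intervalIntegrable_iff, IntegrableOn, qCC, integrable_indicator_iff measurableSet_Ioi,
      IntegrableOn, Measure.restrict_restrict measurableSet_Ioi]
    have h0 : (0 : ℝ) ≤ max |u| |v| := (abs_nonneg u).trans (le_max_left _ _)
    have := (hP.intervalIntegrable_q_mul_C_mul_C i j lam le_rfl h0).1
    refine this.mono_set fun t ht => ⟨ht.1, ht.2.2.trans ?_⟩
    exact max_le_max (le_abs_self u) (le_abs_self v)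
  have hsmul : ∀ i j (L : (ℂ × ℂ) →L[ℂ] (ℂ × ℂ)),
      IntervalIntegrable (fun t => P.qCC lam i j t • L) volume u v := fun i j L =>
    ⟨(h i j).1.smul_const L, (h i j).2.smul_const L⟩
  exact ((hsmul 0 1 _).add (hsmul 1 1 _)).add (hsmul 0 0 _)

/-- `w = (u, v)` are the amplitudes of a solution, with value `β` at the singular point. -/
def IsAmplitude (P : SingularSL) (lam : ℂ) (β : ℂ × ℂ) (w : ℝ → ℂ × ℂ) : Prop :=
  Continuous w ∧ ∀ x, w x = β + ∫ t in P.a..x, P.amplitudeSystem lam t (w t)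

theorem Admissible.exists_isAmplitude (hP : P.Admissible) (lam : ℂ) (β : ℂ × ℂ) :
    ∃ w, P.IsAmplitude lam β w :=
  exists_continuous_eq_add_integral (hP.intervalIntegrable_amplitudeSystem lam) P.a β

section IsAmplitude

variable {lam : ℂ} {β : ℂ × ℂ} {w : ℝ → ℂ × ℂ}

theorem IsAmplitude.intervalIntegrable (hw : P.IsAmplitude lam β w) (hP : P.Admissible) (u v : ℝ) :
    IntervalIntegrable (fun t => P.amplitudeSystem lam t (w t)) volume u v :=
  intervalIntegrable_clm_apply (hP.intervalIntegrable_amplitudeSystem lam u v) hw.1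

theorem IsAmplitude.apply_a (hw : P.IsAmplitude lam β w) : w P.a = β := by
  rw [hw.2, intervalIntegral.integral_same, add_zero]

theorem IsAmplitude.sub_eq_integral (hw : P.IsAmplitude lam β w) (hP : P.Admissible) (u v : ℝ) :
    w v = w u + ∫ t in u..v, P.amplitudeSystem lam t (w t) := by
  rw [hw.2 v, hw.2 u, add_assoc, intervalIntegral.integral_add_adjacent_intervals
    (hw.intervalIntegrable hP _ _) (hw.intervalIntegrable hP _ _)]

/-- The coefficients are integrable across `a`, so a zero at any point, on either side, propagates
to `a`. -/
theorem IsAmplitude.eq_zero (hw : P.IsAmplitude lam β w) (hP : P.Admissible) {x₀ : ℝ}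
    (h0 : w x₀ = 0) : β = 0 := by
  rw [← hw.apply_a]
  refine eq_zero_of_eq_integral_clm (hP.intervalIntegrable_amplitudeSystem lam x₀ P.a)
    hw.1.continuousOn fun y _ => ?_
  rw [hw.sub_eq_integral hP x₀ y, h0, zero_add]

theorem IsAmplitude.add {β' : ℂ × ℂ} {w' : ℝ → ℂ × ℂ} (hw : P.IsAmplitude lam β w)
    (hw' : P.IsAmplitude lam β' w') (hP : P.Admissible) :
    P.IsAmplitude lam (β + β') (w + w') := by
  refine ⟨hw.1.add hw'.1, fun x => ?_⟩
  simp only [Pi.add_apply, map_add]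
  rw [intervalIntegral.integral_add (hw.intervalIntegrable hP _ _) (hw'.intervalIntegrable hP _ _),
    hw.2 x, hw'.2 x]
  abel

theorem IsAmplitude.smul (hw : P.IsAmplitude lam β w) (c : ℂ) :
    P.IsAmplitude lam (c • β) (c • w) := by
  refine ⟨hw.1.const_smul c, fun x => ?_⟩
  simp only [Pi.smul_apply, map_smul]
  rw [intervalIntegral.integral_smul, hw.2 x, smul_add]

theorem IsAmplitude.intervalIntegrable_mul (hw : P.IsAmplitude lam β w) (hP : P.Admissible)
    (i : Fin 2) {u v : ℝ} (hu : 0 ≤ u) (hv : 0 ≤ v) :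
    IntervalIntegrable (fun t => P.C i lam t * P.q t * P.ofAmplitude lam w t) volume u v := by
  have h1 := (hP.intervalIntegrable_q_mul_C_mul_C i 0 lam hu hv).mul_continuousOn
    (hw.1.fst.continuousOn)
  have h2 := (hP.intervalIntegrable_q_mul_C_mul_C i 1 lam hu hv).mul_continuousOn
    (hw.1.snd.continuousOn)
  refine (h1.add h2).congr fun t _ => ?_
  simp only [ofAmplitude]
  ring

theorem IsAmplitude.eq_add_integral (hw : P.IsAmplitude lam β w) (hP : P.Admissible) {u v : ℝ}
    (hu : 0 ≤ u) (hv : 0 ≤ v) :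
    w v = w u + (-∫ t in u..v, P.C 1 lam t * P.q t * P.ofAmplitude lam w t,
      ∫ t in u..v, P.C 0 lam t * P.q t * P.ofAmplitude lam w t) := by
  rw [hw.sub_eq_integral hP u v]
  congr 1
  have hI := hw.intervalIntegrable hP u v
  have hpos : ∀ t ∈ Set.uIoc u v, 0 < t := fun t ht => (le_min hu hv).trans_lt ht.1
  refine Prod.ext ?_ ?_
  · have := (ContinuousLinearMap.fst ℂ ℂ ℂ).intervalIntegral_comp_comm hI
    simp only [ContinuousLinearMap.coe_fst'] at this
    rw [← this, ← intervalIntegral.integral_neg]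
    refine intervalIntegral.integral_congr_ae (Eventually.of_forall fun t ht => ?_)
    rw [amplitudeSystem_apply lam (hpos t ht)]
  · have := (ContinuousLinearMap.snd ℂ ℂ ℂ).intervalIntegral_comp_comm hI
    simp only [ContinuousLinearMap.coe_snd'] at this
    rw [← this]
    refine intervalIntegral.integral_congr_ae (Eventually.of_forall fun t ht => ?_)
    rw [amplitudeSystem_apply lam (hpos t ht)]

end IsAmplitude

/-! ### The integral equation: existence, uniqueness, values at the origin -/

/-- The initial amplitudes of `s_j`. -/
def unitAmplitude : Fin 2 → ℂ × ℂ := ![(1, 0), (0, 1)]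

theorem C_eq_unitAmplitude (P : SingularSL) (j : Fin 2) (lam : ℂ) (x : ℝ) :
    P.C j lam x = (unitAmplitude j).1 * P.C 0 lam x + (unitAmplitude j).2 * P.C 1 lam x := by
  fin_cases j <;> simp [unitAmplitude]

theorem IsAmplitude.solvesIntegralEq {lam : ℂ} {j : Fin 2} {w : ℝ → ℂ × ℂ}
    (hw : P.IsAmplitude lam (unitAmplitude j) w) (hP : P.Admissible) :
    P.SolvesIntegralEq j lam (P.ofAmplitude lam w) := by
  intro x hx _
  have h0 := (hw.intervalIntegrable_mul hP 0 hP.a_pos.le hx).const_mul (P.C 1 lam x)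
  have h1 := (hw.intervalIntegrable_mul hP 1 hP.a_pos.le hx).const_mul (P.C 0 lam x)
  have e : (fun t => P.g lam x t * P.q t * P.ofAmplitude lam w t) = fun t =>
      P.C 1 lam x * (P.C 0 lam t * P.q t * P.ofAmplitude lam w t) -
      P.C 0 lam x * (P.C 1 lam t * P.q t * P.ofAmplitude lam w t) := by
    ext t; simp only [g]; ring
  rw [e]
  refine ⟨h0.sub h1, ?_⟩
  rw [intervalIntegral.integral_sub h0 h1, intervalIntegral.integral_const_mul,
    intervalIntegral.integral_const_mul, C_eq_unitAmplitude, ofAmplitude,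
    hw.eq_add_integral hP hP.a_pos.le hx, hw.apply_a]
  simp only [Prod.fst_add, Prod.snd_add]
  ring

theorem Admissible.exists_g_ne_zero (hP : P.Admissible) (lam : ℂ) {x : ℝ} (hx : x ≠ P.a)
    {S : Set ℝ} (hS : S ∈ 𝓝 x) : ∃ y ∈ S, P.g lam y x ≠ 0 := by
  by_contra! h
  have h1 : HasDerivAt (fun y => P.g lam y x) (P.C 0 lam x * P.dC 1 lam x -
      P.dC 0 lam x * P.C 1 lam x) x :=
    ((hP.hasDerivAt_C 1 lam hx).const_mul _).sub ((hP.hasDerivAt_C 0 lam hx).mul_const _)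
  rw [hP.wronskian lam hx] at h1
  have h2 : HasDerivAt (fun y => P.g lam y x) 0 x :=
    (hasDerivAt_const x (0 : ℂ)).congr_of_eventuallyEq (by filter_upwards [hS] with y hy using h y hy)
  exact one_ne_zero (h1.unique h2)

/-- The integral equation gives integrability only of `g(y, t) q(t) d(t)`. Two values of `y` beyond
`x` as seen from `a`, with nonzero `g` between them, allow the separate products `C_i q d` to be
recovered. -/
theorem Admissible.exists_two_points (hP : P.Admissible) (lam : ℂ) {x : ℝ} (hx0 : 0 < x)
    (hx : x ≠ P.a) :
    ∃ y z : ℝ, (0 ≤ y ∧ y ≠ P.a ∧ x ∈ Set.uIcc P.a y) ∧ (0 ≤ z ∧ z ≠ P.a ∧ x ∈ Set.uIcc P.a z) ∧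
      P.g lam z y ≠ 0 := by
  have ha := hP.a_pos
  rcases lt_or_gt_of_ne hx with h | h
  · have hy : x / 2 ≠ P.a := by intro h'; linarith
    obtain ⟨z, hz, hg⟩ := hP.exists_g_ne_zero lam hy
      (Ioo_mem_nhds (half_pos hx0) (half_lt_self hx0))
    refine ⟨x / 2, z, ⟨by linarith, hy, ?_⟩, ⟨hz.1.le, (hz.2.trans h).ne, ?_⟩, hg⟩
    · rw [Set.mem_uIcc]; right; constructor <;> linarith
    · rw [Set.mem_uIcc]; right; exact ⟨hz.2.le, h.le⟩
  · have hy : x + 1 ≠ P.a := by intro h'; linarith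
    obtain ⟨z, hz, hg⟩ := hP.exists_g_ne_zero lam hy (Ioi_mem_nhds (lt_add_one x))
    have hz : x < z := hz
    refine ⟨x + 1, z, ⟨by linarith, hy, ?_⟩, ⟨by linarith, (h.trans hz).ne', ?_⟩, hg⟩
    · rw [Set.mem_uIcc]; left; constructor <;> linarith
    · rw [Set.mem_uIcc]; left; exact ⟨h.le, hz.le⟩

theorem Admissible.eq_zero_of_homogeneous (hP : P.Admissible) (lam : ℂ) {d : ℝ → ℂ}
    (hd : ∀ x : ℝ, 0 ≤ x → x ≠ P.a →
      IntervalIntegrable (fun t => P.g lam x t * P.q t * d t) volume P.a x ∧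
      d x = ∫ t in P.a..x, P.g lam x t * P.q t * d t) {x : ℝ} (hx0 : 0 ≤ x) (hx : x ≠ P.a) :
    d x = 0 := by
  have ha := hP.a_pos
  have hae : ∀ᵐ t : ℝ, t ≠ P.a := by simp [ae_iff, measure_singleton]
  have hpos : ∀ x : ℝ, 0 < x → x ≠ P.a → d x = 0 := by
    intro x hx0 hx
    obtain ⟨y, z, ⟨hy0, hy, hxy⟩, ⟨hz0, hz, hxz⟩, hg⟩ := hP.exists_two_points lam hx0 hx
    have hiy := (hd y hy0 hy).1.mono_set (Set.uIcc_subset_uIcc Set.left_mem_uIcc hxy)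
    have hiz := (hd z hz0 hz).1.mono_set (Set.uIcc_subset_uIcc Set.left_mem_uIcc hxz)
    have hI : ∀ i, IntervalIntegrable (fun t => P.C i lam t * P.q t * d t) volume P.a x := by
      -- Cramer's rule: `C_i(t) g(z, y) = C_i(y) g(z, t) - C_i(z) g(y, t)`.
      intro i
      have := ((hiz.const_mul (P.C i lam y)).sub (hiy.const_mul (P.C i lam z))).const_mul
        (P.g lam z y)⁻¹
      refine this.congr fun t _ => ?_
      rw [inv_mul_eq_iff_eq_mul₀ hg]
      simp only [g]
      fin_cases i <;> simp <;> ring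
    have hIs : ∀ i, ∀ v ∈ Set.uIcc P.a x,
        IntervalIntegrable (fun t => P.C i lam t * P.q t * d t) volume P.a v := fun i v hv =>
      (hI i).mono_set (Set.uIcc_subset_uIcc Set.left_mem_uIcc hv)
    set w : ℝ → ℂ × ℂ := fun v => (-∫ t in P.a..v, P.C 1 lam t * P.q t * d t,
      ∫ t in P.a..v, P.C 0 lam t * P.q t * d t) with hw
    have hwc : ContinuousOn w (Set.uIcc P.a x) :=
      (intervalIntegral.continuousOn_primitive_interval' (hI 1) Set.left_mem_uIcc).neg.prodMk
        (intervalIntegral.continuousOn_primitive_interval' (hI 0) Set.left_mem_uIcc)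
    have hdw : ∀ v ∈ Set.uIcc P.a x, v ≠ P.a → d v = P.ofAmplitude lam w v := by
      intro v hv hva
      have hv0 : 0 ≤ v := (le_min ha.le hx0.le).trans hv.1
      rw [(hd v hv0 hva).2, ofAmplitude, hw]
      have e : (fun t => P.g lam v t * P.q t * d t) = fun t =>
          P.C 1 lam v * (P.C 0 lam t * P.q t * d t) -
          P.C 0 lam v * (P.C 1 lam t * P.q t * d t) := by
        ext t; simp only [g]; ring
      rw [e, intervalIntegral.integral_sub ((hIs 0 v hv).const_mul _) ((hIs 1 v hv).const_mul _),
        intervalIntegral.integral_const_mul, intervalIntegral.integral_const_mul]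
      ring
    have hwx : w x = 0 := by
      refine eq_zero_of_eq_integral_clm (hP.intervalIntegrable_amplitudeSystem lam P.a x) hwc
        fun v hv => ?_
      have hcongr : ∫ t in P.a..v, P.amplitudeSystem lam t (w t) =
          ∫ t in P.a..v, (-(P.C 1 lam t * P.q t * d t), P.C 0 lam t * P.q t * d t) := by
        refine intervalIntegral.integral_congr_ae ?_
        filter_upwards [hae] with t hta ht
        have htx : t ∈ Set.uIcc P.a x :=
          Set.uIcc_subset_uIcc Set.left_mem_uIcc hv (Set.uIoc_subset_uIcc ht)
        have hv0 : 0 ≤ v := (le_min ha.le hx0.le).trans hv.1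
        have ht0 : 0 < t := (le_min ha.le hv0).trans_lt ht.1
        rw [amplitudeSystem_apply lam ht0, ← hdw t htx hta]
      rw [hcongr]
      have hpair : IntervalIntegrable
          (fun t => (-(P.C 1 lam t * P.q t * d t), P.C 0 lam t * P.q t * d t)) volume P.a v :=
        ⟨(hIs 1 v hv).neg.1.prodMk (hIs 0 v hv).1, (hIs 1 v hv).neg.2.prodMk (hIs 0 v hv).2⟩
      refine Prod.ext ?_ ?_
      · have := (ContinuousLinearMap.fst ℂ ℂ ℂ).intervalIntegral_comp_comm hpair
        simp only [ContinuousLinearMap.coe_fst'] at this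
        rw [← this, intervalIntegral.integral_neg]
      · have := (ContinuousLinearMap.snd ℂ ℂ ℂ).intervalIntegral_comp_comm hpair
        simp only [ContinuousLinearMap.coe_snd'] at this
        rw [← this]
    rw [hdw x Set.right_mem_uIcc hx, ofAmplitude, hwx]
    simp
  rcases hx0.eq_or_lt with rfl | h
  -- At `x = 0` no two points beyond `x` are available in the half-line, but the integral only sees
  -- the interior, where `d` already vanishes almost everywhere.
  · rw [(hd 0 le_rfl hx).2]
    refine (intervalIntegral.integral_congr_ae ?_).trans intervalIntegral.integral_zero
    filter_upwards [hae] with t hta ht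
    have ht0 : 0 < t := (le_min ha.le le_rfl).trans_lt ht.1
    rw [hpos t ht0 hta, mul_zero]
  · exact hpos x h hx

/-- Existence through amplitudes makes the chosen `s_j` a genuine solution, and uniqueness
identifies it off `a`. -/
theorem IsAmplitude.s_eq {lam : ℂ} {j : Fin 2} {w : ℝ → ℂ × ℂ}
    (hw : P.IsAmplitude lam (unitAmplitude j) w) (hP : P.Admissible) {x : ℝ} (hx0 : 0 ≤ x)
    (hx : x ≠ P.a) : P.s j lam x = P.ofAmplitude lam w x := by
  have hsol := hw.solvesIntegralEq hP
  have hs : P.SolvesIntegralEq j lam (P.s j lam) := Classical.epsilon_spec ⟨_, hsol⟩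
  rw [← sub_eq_zero]
  refine hP.eq_zero_of_homogeneous lam (d := fun x => P.s j lam x - P.ofAmplitude lam w x) ?_ hx0 hx
  intro x hx0 hx
  obtain ⟨h1, h2⟩ := hs x hx0 hx
  obtain ⟨h3, h4⟩ := hsol x hx0 hx
  have e : (fun t => P.g lam x t * P.q t * (P.s j lam t - P.ofAmplitude lam w t)) = fun t =>
      P.g lam x t * P.q t * P.s j lam t - P.g lam x t * P.q t * P.ofAmplitude lam w t := by
    ext t; ring
  rw [e]
  refine ⟨h1.sub h3, ?_⟩
  rw [intervalIntegral.integral_sub h1 h3]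
  linear_combination h2 - h4

theorem Admissible.s_zero_ne_zero (hP : P.Admissible) (lam : ℂ) :
    ∃ j, P.s j lam 0 ≠ 0 := by
  by_contra! h
  have ha := hP.a_pos.ne
  obtain ⟨w₀, h₀⟩ := hP.exists_isAmplitude lam (unitAmplitude 0)
  obtain ⟨w₁, h₁⟩ := hP.exists_isAmplitude lam (unitAmplitude 1)
  have e0 := h 0
  have e1 := h 1
  rw [h₀.s_eq hP le_rfl ha, ofAmplitude] at e0
  rw [h₁.s_eq hP le_rfl ha, ofAmplitude] at e1
  have hW := hP.wronskian lam ha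
  -- Both amplitude vectors at `0` are annihilated by the row `(C_0(0), C_1(0))`, which is nonzero
  -- because the Wronskian is `1`.
  have hdet : (w₀ 0).1 * (w₁ 0).2 - (w₀ 0).2 * (w₁ 0).1 = 0 := by
    linear_combination ((w₁ 0).2 * P.dC 1 lam 0 + (w₁ 0).1 * P.dC 0 lam 0) * e0
      - ((w₀ 0).2 * P.dC 1 lam 0 + (w₀ 0).1 * P.dC 0 lam 0) * e1
      - ((w₀ 0).1 * (w₁ 0).2 - (w₀ 0).2 * (w₁ 0).1) * hW
  have hcomb : ∀ c d : ℂ, c • w₀ 0 + d • w₁ 0 = 0 → c = 0 ∧ d = 0 := by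
    intro c d hcd
    have := ((h₀.smul c).add (h₁.smul d) hP).eq_zero hP (x₀ := 0) (by simpa using hcd)
    simpa [unitAmplitude] using this
  obtain ⟨h1, h2⟩ := hcomb (w₁ 0).1 (-(w₀ 0).1) (by
    ext
    · simp; ring
    · simp; linear_combination -hdet)
  obtain ⟨h3, h4⟩ := hcomb (w₁ 0).2 (-(w₀ 0).2) (by
    ext
    · simp; linear_combination hdet
    · simp; ring)
  have := h₀.eq_zero hP (x₀ := 0) (Prod.ext (neg_eq_zero.1 h2) (neg_eq_zero.1 h4))
  simp [unitAmplitude] at this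

/-! ### Plane-wave amplitudes and asymptotics at infinity -/

/-- The normalised plane wave `exp (-i ρ x) / (2 i ρ)`. -/
def planeWave (ρ : ℂ) (x : ℝ) : ℂ := Complex.exp (-(Complex.I * ρ * x)) / (2 * Complex.I * ρ)

/-- The amplitude of `exp (i ρ x)` in the representation of the solution `u C_0 + v C_1` and its
derivative by the plane waves `exp (± i ρ x)`. -/
def waveAmplitude (P : SingularSL) (ρ : ℂ) (w : ℝ → ℂ × ℂ) (x : ℝ) : ℂ :=
  (P.dC 0 (ρ ^ 2) x + Complex.I * ρ * P.C 0 (ρ ^ 2) x) * planeWave ρ x * (w x).1 +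
    (P.dC 1 (ρ ^ 2) x + Complex.I * ρ * P.C 1 (ρ ^ 2) x) * planeWave ρ x * (w x).2

/-- The total potential `ν₀ / (x - a) ^ 2 + q`. -/
def potential (P : SingularSL) (x : ℝ) : ℂ := P.ν₀ / ((x - P.a : ℝ) : ℂ) ^ 2 + P.q x

theorem hasDerivAt_planeWave (ρ : ℂ) (x : ℝ) :
    HasDerivAt (planeWave ρ) (-(Complex.I * ρ) * planeWave ρ x) x := by
  have h1 : HasDerivAt (fun y : ℝ => (y : ℂ)) 1 x := by
    simpa using (hasDerivAt_id x).ofReal_comp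
  have h2 := ((h1.const_mul (Complex.I * ρ)).neg.cexp).div_const (2 * Complex.I * ρ)
  refine h2.congr_deriv ?_
  simp only [planeWave, Pi.neg_apply]
  ring

theorem norm_planeWave (ρ : ℝ) (x : ℝ) : ‖planeWave ρ x‖ = (2 * |ρ|)⁻¹ := by
  have : -(Complex.I * ρ * x) = ((-(ρ * x) : ℝ) : ℂ) * Complex.I := by push_cast; ring
  rw [planeWave, this, norm_div, Complex.norm_exp_ofReal_mul_I]
  simp

theorem Admissible.hasDerivAt_wave_coeff (hP : P.Admissible) (ρ : ℂ) (j : Fin 2) {x : ℝ}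
    (hx : x ≠ P.a) :
    HasDerivAt (fun x => (P.dC j (ρ ^ 2) x + Complex.I * ρ * P.C j (ρ ^ 2) x) * planeWave ρ x)
      (P.ν₀ / ((x - P.a : ℝ) : ℂ) ^ 2 * P.C j (ρ ^ 2) x * planeWave ρ x) x := by
  have h := ((hP.hasDerivAt_dC j (ρ ^ 2) hx).add
    ((hP.hasDerivAt_C j (ρ ^ 2) hx).const_mul (Complex.I * ρ))).mul (hasDerivAt_planeWave ρ x)
  refine h.congr_deriv ?_
  simp only [Pi.add_apply]
  linear_combination (-ρ ^ 2 * P.C j (ρ ^ 2) x * planeWave ρ x) * Complex.I_sq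

theorem ofAmplitude_eq_wave {ρ : ℂ} (hρ : ρ ≠ 0) (w : ℝ → ℂ × ℂ) (x : ℝ) :
    P.ofAmplitude (ρ ^ 2) w x = P.waveAmplitude ρ w x * Complex.exp (Complex.I * ρ * x) +
      P.waveAmplitude (-ρ) w x * Complex.exp (-(Complex.I * ρ * x)) := by
  have h1 : planeWave ρ x * Complex.exp (Complex.I * ρ * x) = (2 * Complex.I * ρ)⁻¹ := by
    rw [planeWave, div_mul_eq_mul_div, ← Complex.exp_add, neg_add_cancel, Complex.exp_zero,
      one_div]
  have h2 : planeWave (-ρ) x * Complex.exp (-(Complex.I * ρ * x)) = -(2 * Complex.I * ρ)⁻¹ := by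
    rw [planeWave, div_mul_eq_mul_div, ← Complex.exp_add, show -(Complex.I * -ρ * x) +
      -(Complex.I * ρ * x) = 0 by ring, Complex.exp_zero, one_div, mul_neg, inv_neg]
  have h3 : (2 * Complex.I * ρ) * (2 * Complex.I * ρ)⁻¹ = 1 :=
    mul_inv_cancel₀ (mul_ne_zero (mul_ne_zero two_ne_zero Complex.I_ne_zero) hρ)
  simp only [waveAmplitude, ofAmplitude, neg_sq]
  linear_combination
    -((P.dC 0 (ρ ^ 2) x + Complex.I * ρ * P.C 0 (ρ ^ 2) x) * (w x).1 +
      (P.dC 1 (ρ ^ 2) x + Complex.I * ρ * P.C 1 (ρ ^ 2) x) * (w x).2) * h1 -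
    ((P.dC 0 (ρ ^ 2) x - Complex.I * ρ * P.C 0 (ρ ^ 2) x) * (w x).1 +
      (P.dC 1 (ρ ^ 2) x - Complex.I * ρ * P.C 1 (ρ ^ 2) x) * (w x).2) * h2 -
    ((w x).1 * P.C 0 (ρ ^ 2) x + (w x).2 * P.C 1 (ρ ^ 2) x) * h3

theorem continuousOn_div_sub_sq (P : SingularSL) {S : Set ℝ} (hS : ∀ x ∈ S, x ≠ P.a) :
    ContinuousOn (fun x : ℝ => P.ν₀ / ((x - P.a : ℝ) : ℂ) ^ 2) S := by
  refine continuousOn_const.div (by fun_prop) fun x hx => ?_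
  exact pow_ne_zero _ (by exact_mod_cast sub_ne_zero.2 (hS x hx))

theorem integrableOn_potential {T : ℝ} (hT : P.a < T) (hq : IntegrableOn P.q (Set.Ioi T)) :
    IntegrableOn P.potential (Set.Ioi T) := by
  refine Integrable.add ?_ hq
  have h := (integrableOn_add_rpow_Ioi_of_lt (a := -2) (m := -P.a) (c := T) (by norm_num)
    (by simpa using hT)).norm.const_mul ‖P.ν₀‖
  refine h.mono' ?_ ?_
  · exact (P.continuousOn_div_sub_sq fun x hx => (hT.trans hx).ne').aestronglyMeasurable
      measurableSet_Ioi
  · refine (ae_restrict_iff' measurableSet_Ioi).2 (Eventually.of_forall fun x hx => ?_)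
    have hpos : 0 < x - P.a := sub_pos.2 (hT.trans hx)
    rw [norm_div, norm_pow, Complex.norm_real, Real.norm_eq_abs, abs_of_pos hpos,
      ← sub_eq_add_neg, Real.rpow_neg hpos.le, Real.rpow_two, Real.norm_of_nonneg (by positivity),
      div_eq_mul_inv]

theorem intervalIntegrable_potential {T : ℝ} (hT : P.a < T) (hq : IntegrableOn P.q (Set.Ioi T))
    {u v : ℝ} (hu : T ≤ u) (hv : T ≤ v) : IntervalIntegrable P.potential volume u v := by
  rw [intervalIntegrable_iff]
  exact (integrableOn_potential hT hq).mono_set fun t ht => (le_min hu hv).trans_lt ht.1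

section Wave

variable {β : ℂ × ℂ} {w : ℝ → ℂ × ℂ} {T : ℝ}

/-- Variation of constants with respect to `exp (± iρx)`: the integrand contains the whole
potential, the term `ν₀ / (x - a) ^ 2` from differentiating the coefficients and `q` from the
derivatives of `u` and `v`. -/
theorem IsAmplitude.waveAmplitude_sub {ρ : ℂ} (hw : P.IsAmplitude (ρ ^ 2) β w) (hP : P.Admissible)
    {u v : ℝ} (hu : P.a < u) (hv : P.a < v) :
    P.waveAmplitude ρ w v = P.waveAmplitude ρ w u +
      ∫ t in u..v, P.potential t * P.ofAmplitude (ρ ^ 2) w t * planeWave ρ t := by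
  have ha := hP.a_pos
  have hne : ∀ x ∈ Set.uIcc u v, x ≠ P.a := fun x hx => ((lt_min hu hv).trans_le hx.1).ne'
  have hx0 : ∀ x ∈ Set.uIcc u v, 0 ≤ x := fun x hx => (ha.trans ((lt_min hu hv).trans_le hx.1)).le
  have hG : ∀ j : Fin 2, ∀ x ∈ Set.uIcc u v, HasDerivAt (fun x => (P.dC j (ρ ^ 2) x +
      Complex.I * ρ * P.C j (ρ ^ 2) x) * planeWave ρ x)
      (P.ν₀ / ((x - P.a : ℝ) : ℂ) ^ 2 * P.C j (ρ ^ 2) x * planeWave ρ x) x := fun j x hx =>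
    hP.hasDerivAt_wave_coeff ρ j (hne x hx)
  have hG' : ∀ j : Fin 2, ContinuousOn (fun x : ℝ => P.ν₀ / ((x - P.a : ℝ) : ℂ) ^ 2 *
      P.C j (ρ ^ 2) x * planeWave ρ x) (Set.uIcc u v) := fun j =>
    ((P.continuousOn_div_sub_sq hne).mul fun x hx =>
      (hP.continuousAt_C j _ (hne x hx)).continuousWithinAt).mul fun x _ =>
      (hasDerivAt_planeWave ρ x).continuousAt.continuousWithinAt
  have hf := fun i => hw.intervalIntegrable_mul hP i (ha.trans hu).le (ha.trans hv).le
  have h0 := integral_deriv_mul_add_mul (u := fun x => (w x).1) (hG 0) (hG' 0) (hf 1).neg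
    fun x hx => by
      rw [hw.eq_add_integral hP (ha.trans hu).le (hx0 x hx)]
      simp
  have h1 := integral_deriv_mul_add_mul (u := fun x => (w x).2) (hG 1) (hG' 1) (hf 0)
    fun x hx => by
      rw [hw.eq_add_integral hP (ha.trans hu).le (hx0 x hx)]
      simp
  have hGc : ∀ j : Fin 2, ContinuousOn (fun x => (P.dC j (ρ ^ 2) x +
      Complex.I * ρ * P.C j (ρ ^ 2) x) * planeWave ρ x) (Set.uIcc u v) := fun j x hx =>
    (hG j x hx).continuousAt.continuousWithinAt
  have hi0 := (((hG' 0).mul (hw.1.fst.continuousOn)).intervalIntegrable (μ := volume)).add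
    ((hf 1).neg.continuousOn_mul (hGc 0))
  have hi1 := (((hG' 1).mul (hw.1.snd.continuousOn)).intervalIntegrable (μ := volume)).add
    ((hf 0).continuousOn_mul (hGc 1))
  have hsum := (intervalIntegral.integral_add hi0 hi1)
  have hE : ∫ t in u..v, P.potential t * P.ofAmplitude (ρ ^ 2) w t * planeWave ρ t =
      P.waveAmplitude ρ w v - P.waveAmplitude ρ w u := by
    simp only [waveAmplitude]
    rw [add_sub_add_comm, h0, h1]
    refine Eq.trans ?_ hsum
    refine intervalIntegral.integral_congr fun t ht => ?_
    have hW := hP.wronskian (ρ ^ 2) (hne t ht)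
    simp only [potential, ofAmplitude, Pi.neg_apply, Pi.mul_apply]
    linear_combination (-(P.q t * ((w t).1 * P.C 0 (ρ ^ 2) t + (w t).2 * P.C 1 (ρ ^ 2) t) *
      planeWave ρ t)) * hW
  rw [hE]
  ring

theorem IsAmplitude.continuousOn_waveAmplitude {ρ : ℂ} (hw : P.IsAmplitude (ρ ^ 2) β w)
    (hP : P.Admissible) : ContinuousOn (P.waveAmplitude ρ w) (Set.Ioi P.a) := by
  intro x hx
  have hx : x ≠ P.a := ne_of_gt hx
  exact (((hP.hasDerivAt_wave_coeff ρ 0 hx).continuousAt.mul hw.1.fst.continuousAt).add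
    ((hP.hasDerivAt_wave_coeff ρ 1 hx).continuousAt.mul
      hw.1.snd.continuousAt)).continuousWithinAt

theorem norm_exp_I_mul (ρ x : ℝ) : ‖Complex.exp (Complex.I * ρ * x)‖ = 1 := by
  have : Complex.I * ρ * x = ((ρ * x : ℝ) : ℂ) * Complex.I := by push_cast; ring
  rw [this, Complex.norm_exp_ofReal_mul_I]

theorem norm_exp_neg_I_mul (ρ x : ℝ) : ‖Complex.exp (-(Complex.I * ρ * x))‖ = 1 := by
  rw [Complex.exp_neg, norm_inv, norm_exp_I_mul, inv_one]

theorem norm_ofAmplitude_le {ρ : ℝ} (hρ : ρ ≠ 0) (w : ℝ → ℂ × ℂ) (x : ℝ) :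
    ‖P.ofAmplitude ((ρ : ℂ) ^ 2) w x‖ ≤
      ‖P.waveAmplitude ρ w x‖ + ‖P.waveAmplitude (-ρ) w x‖ := by
  rw [ofAmplitude_eq_wave (by exact_mod_cast hρ)]
  refine (norm_add_le _ _).trans_eq ?_
  rw [norm_mul, norm_mul, norm_exp_I_mul, norm_exp_neg_I_mul, mul_one, mul_one]

/-- Gronwall for the two wave amplitudes, uniform in both endpoints and in either order. Forward it
bounds the solution; backward from infinity it shows that vanishing limits force the zero solution.
-/
theorem IsAmplitude.norm_wave_le {ρ : ℝ} (hρ : ρ ≠ 0) (hw : P.IsAmplitude ((ρ : ℂ) ^ 2) β w)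
    (hP : P.Admissible) (hT : P.a < T) (hq : IntegrableOn P.q (Set.Ioi T)) :
    ∃ K : ℝ, ∀ u ≥ T, ∀ v ≥ T, ‖P.waveAmplitude ρ w v‖ + ‖P.waveAmplitude (-ρ) w v‖ ≤
      K * (‖P.waveAmplitude ρ w u‖ + ‖P.waveAmplitude (-ρ) w u‖) := by
  set n : ℝ → ℝ := fun t => |ρ|⁻¹ * ‖P.potential t‖ with hn
  have hn0 : ∀ t, 0 ≤ n t := fun t => by positivity
  have hnI : IntegrableOn n (Set.Ioi T) := (integrableOn_potential hT hq).norm.const_mul _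
  set Z : ℝ → ℝ := fun x => ‖P.waveAmplitude ρ w x‖ + ‖P.waveAmplitude (-ρ) w x‖ with hZ
  have hw' : P.IsAmplitude ((-ρ : ℂ) ^ 2) β w := by rwa [neg_sq]
  have hZc : ContinuousOn Z (Set.Ioi P.a) :=
    (hw.continuousOn_waveAmplitude hP).norm.add (hw'.continuousOn_waveAmplitude hP).norm
  refine ⟨2 * Real.exp (2 * ∫ t in Set.Ioi T, n t), fun u hu v hv => ?_⟩
  have hsub : ∀ y ∈ Set.uIcc u v, T ≤ y := fun y hy => (le_min hu hv).trans hy.1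
  have hZc' : ContinuousOn Z (Set.uIcc u v) := hZc.mono fun y hy => hT.trans_le (hsub y hy)
  have hnii : ∀ y ∈ Set.uIcc u v, IntervalIntegrable n volume u y := fun y hy =>
    ((intervalIntegrable_potential hT hq hu (hsub y hy)).norm).const_mul _
  have hone : ∀ (ρ' : ℝ), |ρ'| = |ρ| → (ρ' : ℂ) ^ 2 = (ρ : ℂ) ^ 2 → ∀ y ∈ Set.uIcc u v,
      ‖∫ t in u..y, P.potential t * P.ofAmplitude ((ρ' : ℂ) ^ 2) w t * planeWave ρ' t‖ ≤
        |∫ t in u..y, n t * Z t| / 2 := by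
    intro ρ' h1 h2 y hy
    have hs := Set.uIcc_subset_uIcc Set.left_mem_uIcc hy
    have : |∫ t in u..y, n t * Z t| / 2 = |∫ t in u..y, n t * Z t / 2| := by
      rw [intervalIntegral.integral_div, abs_div, abs_two]
    rw [this]
    refine intervalIntegral.norm_integral_le_abs_of_norm_le (Eventually.of_forall fun t => ?_)
      (((hnii y hy).mul_continuousOn (hZc'.mono hs)).div_const 2)
    have h3 := norm_ofAmplitude_le (P := P) hρ w t
    rw [norm_mul, norm_mul, norm_planeWave, h2, h1, hn]
    have h4 : ‖P.potential t‖ * ‖P.ofAmplitude ((ρ : ℂ) ^ 2) w t‖ * (2 * |ρ|)⁻¹ ≤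
        ‖P.potential t‖ * Z t * (2 * |ρ|)⁻¹ := by gcongr
    refine h4.trans_eq ?_
    rw [mul_inv]; ring
  have hmain : ∀ y ∈ Set.uIcc u v, Z y ≤ Z u + |∫ t in u..y, n t * Z t| := by
    intro y hy
    have ha := hT.trans_le hu
    have hb := hT.trans_le (hsub y hy)
    have e1 := hw.waveAmplitude_sub hP ha hb
    have e2 := hw'.waveAmplitude_sub hP ha hb
    have n1 := hone ρ rfl rfl y hy
    have n2 := hone (-ρ) (abs_neg ρ) (by push_cast; rw [neg_sq]) y hy
    push_cast at n2
    have m1 := norm_add_le (P.waveAmplitude ρ w u)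
      (∫ t in u..y, P.potential t * P.ofAmplitude ((ρ : ℂ) ^ 2) w t * planeWave ρ t)
    have m2 := norm_add_le (P.waveAmplitude (-ρ) w u)
      (∫ t in u..y, P.potential t * P.ofAmplitude ((-ρ : ℂ) ^ 2) w t * planeWave (-ρ) t)
    rw [← e1] at m1
    rw [← e2] at m2
    simp only [hZ] at n1 n2 ⊢
    linarith
  have hg := le_exp_of_le_add_abs_integral hn0 (hnii v Set.right_mem_uIcc) hZc'
    (fun y _ => by positivity) hmain
  refine hg.trans ?_
  have hle : |∫ t in u..v, n t| ≤ ∫ t in Set.Ioi T, n t := by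
    rw [intervalIntegral.abs_intervalIntegral_eq, abs_of_nonneg (setIntegral_nonneg
      measurableSet_uIoc fun t _ => hn0 t)]
    exact setIntegral_mono_set hnI (Eventually.of_forall hn0)
      (Eventually.of_forall fun t ht => (le_min hu hv).trans_lt ht.1)
  have hZu : 0 ≤ Z u := by positivity
  calc 2 * Z u * Real.exp (2 * |∫ t in u..v, n t|)
      ≤ 2 * Z u * Real.exp (2 * ∫ t in Set.Ioi T, n t) := by gcongr
    _ = _ := by ring

theorem IsAmplitude.exists_tendsto_waveAmplitude {ρ : ℝ} (hρ : ρ ≠ 0)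
    (hw : P.IsAmplitude ((ρ : ℂ) ^ 2) β w) (hP : P.Admissible) :
    ∃ ℓ, Tendsto (P.waveAmplitude ρ w) atTop (𝓝 ℓ) := by
  obtain ⟨T, hT, -, hq⟩ := hP.q_mem
  obtain ⟨K, hK⟩ := hw.norm_wave_le hρ hP hT hq
  set f : ℝ → ℂ := fun t => P.potential t * P.ofAmplitude ((ρ : ℂ) ^ 2) w t * planeWave ρ t
  have hcont : ContinuousOn (fun t => P.ofAmplitude ((ρ : ℂ) ^ 2) w t * planeWave ρ t)
      (Set.Ioi T) := by
    intro t ht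
    have hta : t ≠ P.a := (hT.trans ht).ne'
    exact (((hw.1.fst.continuousAt.mul (hP.continuousAt_C 0 _ hta)).add
      (hw.1.snd.continuousAt.mul (hP.continuousAt_C 1 _ hta))).mul
      (hasDerivAt_planeWave ρ t).continuousAt).continuousWithinAt
  have hf : IntegrableOn f (Set.Ioi T) := by
    have := (integrableOn_potential hT hq).mul_bdd
      (c := K * (‖P.waveAmplitude ρ w T‖ + ‖P.waveAmplitude (-ρ) w T‖) * (2 * |ρ|)⁻¹)
      (hcont.aestronglyMeasurable measurableSet_Ioi) (by
        refine (ae_restrict_iff' measurableSet_Ioi).2 (Eventually.of_forall fun t ht => ?_)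
        rw [norm_mul, norm_planeWave]
        have := (norm_ofAmplitude_le (P := P) hρ w t).trans (hK T le_rfl t (le_of_lt ht))
        gcongr)
    refine this.congr (Eventually.of_forall fun t => ?_)
    simp only [f]; ring
  refine ⟨_, ((intervalIntegral_tendsto_integral_Ioi T hf tendsto_id).const_add
    (P.waveAmplitude ρ w T)).congr' ?_⟩
  filter_upwards [eventually_ge_atTop T] with x hx
  exact (hw.waveAmplitude_sub hP hT (hT.trans_le hx)).symm

/-- Letting `u → ∞` in the backward bound kills both wave amplitudes at `T`; inverting the
plane-wave and Wronskian systems there gives `w T = 0`. -/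
theorem IsAmplitude.eq_zero_of_tendsto {ρ : ℝ} (hρ : ρ ≠ 0)
    (hw : P.IsAmplitude ((ρ : ℂ) ^ 2) β w) (hP : P.Admissible)
    (h1 : Tendsto (P.waveAmplitude ρ w) atTop (𝓝 0))
    (h2 : Tendsto (P.waveAmplitude (-ρ) w) atTop (𝓝 0)) : β = 0 := by
  obtain ⟨T, hT, -, hq⟩ := hP.q_mem
  obtain ⟨K, hK⟩ := hw.norm_wave_le hρ hP hT hq
  have hlim : Tendsto (fun u => K * (‖P.waveAmplitude ρ w u‖ + ‖P.waveAmplitude (-ρ) w u‖))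
      atTop (𝓝 0) := by
    simpa using (h1.norm.add h2.norm).const_mul K
  have hle : ‖P.waveAmplitude ρ w T‖ + ‖P.waveAmplitude (-ρ) w T‖ ≤ 0 :=
    ge_of_tendsto hlim ((eventually_ge_atTop T).mono fun u hu => hK u hu T le_rfl)
  have n1 := norm_nonneg (P.waveAmplitude ρ w T)
  have n2 := norm_nonneg (P.waveAmplitude (-ρ) w T)
  have z1 : P.waveAmplitude ρ w T = 0 := norm_eq_zero.1 (by linarith)
  have z2 : P.waveAmplitude (-ρ) w T = 0 := norm_eq_zero.1 (by linarith)
  have hρc : (ρ : ℂ) ≠ 0 := by exact_mod_cast hρ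
  have hpw : ∀ ρ' : ℝ, ρ' ≠ 0 → planeWave ρ' T ≠ 0 := fun ρ' h => by
    rw [← norm_pos_iff, norm_planeWave]; positivity
  have p1 := hpw ρ hρ
  have p2 := hpw (-ρ) (neg_ne_zero.2 hρ)
  push_cast at p2
  simp only [waveAmplitude, neg_sq] at z1 z2
  set C₀ := P.C 0 ((ρ : ℂ) ^ 2) T
  set C₁ := P.C 1 ((ρ : ℂ) ^ 2) T
  set D₀ := P.dC 0 ((ρ : ℂ) ^ 2) T
  set D₁ := P.dC 1 ((ρ : ℂ) ^ 2) T
  have y1 : (D₀ + Complex.I * ρ * C₀) * (w T).1 + (D₁ + Complex.I * ρ * C₁) * (w T).2 = 0 := by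
    refine (mul_eq_zero.1 ?_).resolve_right p1
    linear_combination z1
  have y2 : (D₀ - Complex.I * ρ * C₀) * (w T).1 + (D₁ - Complex.I * ρ * C₁) * (w T).2 = 0 := by
    refine (mul_eq_zero.1 ?_).resolve_right p2
    linear_combination z2
  have s1 : D₀ * (w T).1 + D₁ * (w T).2 = 0 := by linear_combination (y1 + y2) / 2
  have s0 : C₀ * (w T).1 + C₁ * (w T).2 = 0 := by
    refine (mul_eq_zero.1 ?_).resolve_left (mul_ne_zero Complex.I_ne_zero hρc)
    linear_combination (y1 - y2) / 2
  have hW : C₀ * D₁ - D₀ * C₁ = 1 := hP.wronskian _ hT.ne'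
  refine hw.eq_zero hP (x₀ := T) (Prod.ext ?_ ?_)
  · change (w T).1 = 0
    linear_combination D₁ * s0 - C₁ * s1 - (w T).1 * hW
  · change (w T).2 = 0
    linear_combination C₀ * s1 - D₀ * s0 - (w T).2 * hW

end Wave

/-- At a positive spectral parameter the solutions behave like combinations of plane waves, with
the coefficients given by an invertible matrix. -/
theorem Admissible.exists_asymptotics_s (hP : P.Admissible) {ρ : ℝ} (hρ : ρ ≠ 0) :
    ∃ M : Matrix (Fin 2) (Fin 2) ℂ, M.det ≠ 0 ∧ ∀ β : Fin 2 → ℂ,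
      Tendsto (fun x : ℝ => ∑ j, β j * P.s j ((ρ : ℂ) ^ 2) x -
        ((M.mulVec β) 0 * Complex.exp (Complex.I * ρ * x) +
          (M.mulVec β) 1 * Complex.exp (-(Complex.I * ρ * x)))) atTop (𝓝 0) := by
  have hex : ∀ j : Fin 2, ∃ w ℓ ℓ', P.IsAmplitude ((ρ : ℂ) ^ 2) (unitAmplitude j) w ∧
      Tendsto (P.waveAmplitude ρ w) atTop (𝓝 ℓ) ∧
      Tendsto (P.waveAmplitude (-ρ) w) atTop (𝓝 ℓ') := by
    intro j
    obtain ⟨w, hw⟩ := hP.exists_isAmplitude ((ρ : ℂ) ^ 2) (unitAmplitude j)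
    obtain ⟨ℓ, h1⟩ := hw.exists_tendsto_waveAmplitude hρ hP
    have hw' : P.IsAmplitude (((-ρ : ℝ) : ℂ) ^ 2) (unitAmplitude j) w := by
      push_cast; rwa [neg_sq]
    obtain ⟨ℓ', h2⟩ := hw'.exists_tendsto_waveAmplitude (neg_ne_zero.2 hρ) hP
    exact ⟨w, ℓ, ℓ', hw, h1, by simpa using h2⟩
  choose w ℓ ℓ' hw h1 h2 using hex
  -- Rows correspond to `exp (iρx)` and `exp (-iρx)`, columns to `s_1` and `s_2`.
  set M : Matrix (Fin 2) (Fin 2) ℂ := ![ℓ, ℓ'] with hM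
  have hM0 : ∀ β : Fin 2 → ℂ, (M.mulVec β) 0 = β 0 * ℓ 0 + β 1 * ℓ 1 := fun β => by
    simp [hM, Matrix.mulVec, dotProduct, mul_comm]
  have hM1 : ∀ β : Fin 2 → ℂ, (M.mulVec β) 1 = β 0 * ℓ' 0 + β 1 * ℓ' 1 := fun β => by
    simp [hM, Matrix.mulVec, dotProduct, mul_comm]
  have hamp : ∀ β : Fin 2 → ℂ, P.IsAmplitude ((ρ : ℂ) ^ 2) (β 0, β 1) (β 0 • w 0 + β 1 • w 1) := by
    intro β
    convert! ((hw 0).smul (β 0)).add ((hw 1).smul (β 1)) hP using 1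
    simp [unitAmplitude]
  have hlin : ∀ (ρ' : ℂ) (β : Fin 2 → ℂ), P.waveAmplitude ρ' (β 0 • w 0 + β 1 • w 1) =
      fun x => β 0 * P.waveAmplitude ρ' (w 0) x + β 1 * P.waveAmplitude ρ' (w 1) x := by
    intro ρ' β
    ext x
    simp only [waveAmplitude, Pi.add_apply, Pi.smul_apply, Prod.fst_add, Prod.snd_add,
      Prod.smul_fst, Prod.smul_snd, smul_eq_mul]
    ring
  have hlim1 : ∀ β : Fin 2 → ℂ, Tendsto (P.waveAmplitude ρ (β 0 • w 0 + β 1 • w 1)) atTop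
      (𝓝 ((M.mulVec β) 0)) := fun β => by
    rw [hlin, hM0]
    exact ((h1 0).const_mul _).add ((h1 1).const_mul _)
  have hlim2 : ∀ β : Fin 2 → ℂ, Tendsto (P.waveAmplitude (-ρ) (β 0 • w 0 + β 1 • w 1)) atTop
      (𝓝 ((M.mulVec β) 1)) := fun β => by
    rw [hlin, hM1]
    exact ((h2 0).const_mul _).add ((h2 1).const_mul _)
  refine ⟨M, fun hdet => ?_, fun β => ?_⟩
  · obtain ⟨β, hβ, hMβ⟩ := Matrix.exists_mulVec_eq_zero_iff.2 hdet
    have t1 := hlim1 β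
    have t2 := hlim2 β
    rw [hMβ] at t1 t2
    have := (hamp β).eq_zero_of_tendsto hρ hP t1 t2
    refine hβ (funext fun j => ?_)
    fin_cases j
    · exact congrArg Prod.fst this
    · exact congrArg Prod.snd this
  · have t1 := (tendsto_iff_norm_sub_tendsto_zero.1 (hlim1 β)).add
      (tendsto_iff_norm_sub_tendsto_zero.1 (hlim2 β))
    rw [add_zero] at t1
    refine squeeze_zero_norm' ?_ t1
    filter_upwards [eventually_gt_atTop P.a] with x hx
    have hx0 : 0 ≤ x := (hP.a_pos.trans hx).le
    have hs : ∑ j, β j * P.s j ((ρ : ℂ) ^ 2) x =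
        P.ofAmplitude ((ρ : ℂ) ^ 2) (β 0 • w 0 + β 1 • w 1) x := by
      rw [Fin.sum_univ_two, (hw 0).s_eq hP hx0 hx.ne', (hw 1).s_eq hP hx0 hx.ne']
      simp only [ofAmplitude, Pi.add_apply, Pi.smul_apply, Prod.fst_add, Prod.snd_add,
        Prod.smul_fst, Prod.smul_snd, smul_eq_mul]
      ring
    rw [hs, ofAmplitude_eq_wave (by exact_mod_cast hρ)]
    have e : ∀ A B c d E F : ℂ, A * E + B * F - (c * E + d * F) = (A - c) * E + (B - d) * F := by
      intros; ring
    rw [e]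
    refine (norm_add_le _ _).trans_eq ?_
    rw [norm_mul, norm_mul, norm_exp_I_mul, norm_exp_neg_I_mul, mul_one, mul_one]

theorem Admissible.exists_asymptotics (hP : P.Admissible) {ρ : ℝ} (hρ : ρ ≠ 0) :
    ∃ M : Matrix (Fin 2) (Fin 2) ℂ, M.det ≠ 0 ∧ ∀ (y : ℝ → ℂ) (α : Fin 2 → ℂ),
      (∀ x : ℝ, 0 ≤ x → x ≠ P.a → y x = ∑ k, α k * P.σ k ((ρ : ℂ) ^ 2) x) →
      Tendsto (fun x : ℝ => y x - ((M.mulVec α) 0 * Complex.exp (Complex.I * ρ * x) +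
          (M.mulVec α) 1 * Complex.exp (-(Complex.I * ρ * x)))) atTop (𝓝 0) := by
  obtain ⟨M, hM, h⟩ := hP.exists_asymptotics_s hρ
  refine ⟨M * P.A, by rw [Matrix.det_mul]; exact mul_ne_zero hM hP.det_A, fun y α hy => ?_⟩
  refine (h (P.A.mulVec α)).congr' ?_
  filter_upwards [eventually_gt_atTop P.a] with x hx
  rw [hy x (hP.a_pos.trans hx).le hx.ne', Matrix.mulVec_mulVec]
  congr 1
  simp only [σ, if_neg hx.not_gt, Matrix.mulVec, dotProduct, Fin.sum_univ_two]
  ring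

/-! ### Independence of plane waves, Jost solutions and the conclusion -/

theorem eq_zero_of_tendsto_plane_waves {ρ : ℝ} (hρ : ρ ≠ 0) {c d : ℂ}
    (h : Tendsto (fun x : ℝ => c * Complex.exp (Complex.I * ρ * x) +
      d * Complex.exp (-(Complex.I * ρ * x))) atTop (𝓝 0)) : c = 0 ∧ d = 0 := by
  have hρc : (ρ : ℂ) ≠ 0 := by exact_mod_cast hρ
  -- A quarter-period shift multiplies the two waves by `i` and `-i`, so each wave separately tends
  -- to zero while its modulus is constant.
  have hs : Tendsto (fun x : ℝ => x + Real.pi / (2 * ρ)) atTop atTop :=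
    tendsto_atTop_add_const_right _ _ tendsto_id
  have h' := h.comp hs
  have hexp : ∀ x : ℝ, Complex.exp (Complex.I * ρ * ((x + Real.pi / (2 * ρ) : ℝ) : ℂ)) =
      Complex.I * Complex.exp (Complex.I * ρ * x) := by
    intro x
    have : Complex.I * ρ * ((x + Real.pi / (2 * ρ) : ℝ) : ℂ) =
        Real.pi / 2 * Complex.I + Complex.I * ρ * x := by
      push_cast; field_simp; ring
    rw [this, Complex.exp_add, Complex.exp_pi_div_two_mul_I]
  have h'' : Tendsto (fun x : ℝ => c * Complex.exp (Complex.I * ρ * x) -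
      d * Complex.exp (-(Complex.I * ρ * x))) atTop (𝓝 0) := by
    have := h'.const_mul (-Complex.I)
    rw [mul_zero] at this
    refine this.congr fun x => ?_
    simp only [Function.comp, Complex.exp_neg, hexp, mul_inv, Complex.inv_I]
    linear_combination (-c * Complex.exp (Complex.I * ρ * x) +
      d * (Complex.exp (Complex.I * ρ * x))⁻¹) * Complex.I_sq
  have hc : Tendsto (fun x : ℝ => ‖c‖) atTop (𝓝 0) := by
    have := ((h.add h'').div_const 2).norm
    simp only [add_zero, zero_div, norm_zero] at this
    refine this.congr fun x => ?_
    have e : (c * Complex.exp (Complex.I * ρ * x) + d * Complex.exp (-(Complex.I * ρ * x)) +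
        (c * Complex.exp (Complex.I * ρ * x) - d * Complex.exp (-(Complex.I * ρ * x)))) / 2 =
        c * Complex.exp (Complex.I * ρ * x) := by ring
    rw [e, norm_mul, norm_exp_I_mul, mul_one]
  have hd : Tendsto (fun x : ℝ => ‖d‖) atTop (𝓝 0) := by
    have := ((h.sub h'').div_const 2).norm
    simp only [sub_zero, zero_div, norm_zero] at this
    refine this.congr fun x => ?_
    have e : (c * Complex.exp (Complex.I * ρ * x) + d * Complex.exp (-(Complex.I * ρ * x)) -
        (c * Complex.exp (Complex.I * ρ * x) - d * Complex.exp (-(Complex.I * ρ * x)))) / 2 =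
        d * Complex.exp (-(Complex.I * ρ * x)) := by ring
    rw [e, norm_mul, norm_exp_neg_I_mul, mul_one]
  exact ⟨norm_eq_zero.1 (tendsto_nhds_unique tendsto_const_nhds hc),
    norm_eq_zero.1 (tendsto_nhds_unique tendsto_const_nhds hd)⟩

theorem tendsto_mul_exp_neg_iff (ρ : ℝ) (y : ℝ → ℂ) :
    Tendsto (fun x : ℝ => y x * Complex.exp (-(Complex.I * ρ * x))) atTop (𝓝 1) ↔
      Tendsto (fun x : ℝ => y x - Complex.exp (Complex.I * ρ * x)) atTop (𝓝 0) := by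
  rw [tendsto_iff_norm_sub_tendsto_zero, tendsto_zero_iff_norm_tendsto_zero
    (f := fun x : ℝ => y x - Complex.exp (Complex.I * ρ * x))]
  refine tendsto_congr fun x => ?_
  have e : y x * Complex.exp (-(Complex.I * ρ * x)) - 1 =
      (y x - Complex.exp (Complex.I * ρ * x)) * Complex.exp (-(Complex.I * ρ * x)) := by
    rw [sub_mul, ← Complex.exp_add, add_neg_cancel, Complex.exp_zero]
  rw [e, norm_mul, norm_exp_neg_I_mul, mul_one]

theorem Admissible.isJost_e (hP : P.Admissible) {ρ : ℝ} (hρ : ρ ≠ 0) : P.IsJost ρ (P.e ρ) := by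
  refine Classical.epsilon_spec (p := P.IsJost ρ) ?_
  obtain ⟨M, hM, h⟩ := hP.exists_asymptotics hρ
  set α := M⁻¹.mulVec ![1, 0]
  have hα : M.mulVec α = ![1, 0] := by
    rw [Matrix.mulVec_mulVec, Matrix.mul_nonsing_inv M (isUnit_iff_ne_zero.2 hM),
      Matrix.one_mulVec]
  refine ⟨fun x => ∑ k, α k * P.σ k ((ρ : ℂ) ^ 2) x, ⟨α, fun x _ _ => rfl⟩, ?_⟩
  rw [tendsto_mul_exp_neg_iff]
  have := h _ α fun x _ _ => rfl
  rw [hα] at this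
  simpa using this

theorem Admissible.not_isEigenvalue (hP : P.Admissible) {lam : ℝ} (hlam : 0 < lam) :
    ¬ P.IsEigenvalue (lam : ℂ) := by
  rintro ⟨y, ⟨α, hα⟩, ⟨x, hx0, hx, hyx⟩, -, hlim⟩
  have hρ : Real.sqrt lam ≠ 0 := (Real.sqrt_pos.2 hlam).ne'
  have hsq : ((Real.sqrt lam : ℝ) : ℂ) ^ 2 = lam := by exact_mod_cast Real.sq_sqrt hlam.le
  obtain ⟨M, hM, h⟩ := hP.exists_asymptotics hρ
  have h1 := hlim.sub (h y α (by rw [hsq]; exact hα))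
  simp only [sub_sub_cancel, sub_zero] at h1
  obtain ⟨z0, z1⟩ := eq_zero_of_tendsto_plane_waves hρ h1
  have hα0 : α = 0 := Matrix.eq_zero_of_mulVec_eq_zero hM (by
    ext j; fin_cases j
    · exact z0
    · exact z1)
  exact hyx (by rw [hα x hx0 hx, hα0]; simp)

theorem Admissible.Δ_neg_ne_zero (hP : P.Admissible) {ρ : ℝ} (hρ : ρ ≠ 0) (h0 : P.Δ ρ = 0) :
    P.Δ (-ρ) ≠ 0 := by
  intro h0'
  obtain ⟨⟨α, hα⟩, hlim⟩ := hP.isJost_e hρ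
  obtain ⟨⟨α', hα'⟩, hlim'⟩ := hP.isJost_e (neg_ne_zero.2 hρ)
  rw [tendsto_mul_exp_neg_iff] at hlim hlim'
  push_cast at hα' hlim'
  simp only [neg_sq] at hα'
  obtain ⟨M, hM, h⟩ := hP.exists_asymptotics hρ
  have k1 := hlim.sub (h _ α hα)
  have k2 := hlim'.sub (h _ α' hα')
  rw [sub_zero] at k1 k2
  obtain ⟨a0, a1⟩ := eq_zero_of_tendsto_plane_waves hρ (c := M.mulVec α 0 - 1)
    (d := M.mulVec α 1) (k1.congr fun x => by ring)
  obtain ⟨b0, b1⟩ := eq_zero_of_tendsto_plane_waves hρ (c := M.mulVec α' 0)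
    (d := M.mulVec α' 1 - 1) (k2.congr fun x => by
      rw [show Complex.I * -(ρ : ℂ) * x = -(Complex.I * ρ * x) by ring]; ring)
  have ha := hP.a_pos
  have e1 : ∑ k, α k * P.s k ((ρ : ℂ) ^ 2) 0 = 0 := by
    have := hα 0 le_rfl ha.ne
    simp only [σ, if_pos ha] at this
    rw [← this]; exact h0
  have e2 : ∑ k, α' k * P.s k ((ρ : ℂ) ^ 2) 0 = 0 := by
    have := hα' 0 le_rfl ha.ne
    simp only [σ, if_pos ha] at this
    rw [← this]; exact h0'
  obtain ⟨j, hj⟩ := hP.s_zero_ne_zero ((ρ : ℂ) ^ 2)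
  set β : Fin 2 → ℂ := Pi.single j 1 with hβ
  -- As `M α = (1, 0)` and `M α' = (0, 1)`, the entries of `M β` are the coordinates of `β` in the
  -- basis `α, α'`.
  have hβ' : β = M.mulVec β 0 • α + M.mulVec β 1 • α' := by
    rw [← sub_eq_zero]
    refine Matrix.eq_zero_of_mulVec_eq_zero hM ?_
    rw [Matrix.mulVec_sub, Matrix.mulVec_add, Matrix.mulVec_smul, Matrix.mulVec_smul]
    ext i; fin_cases i
    · change M.mulVec β 0 - (M.mulVec β 0 * M.mulVec α 0 + M.mulVec β 1 * M.mulVec α' 0) = 0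
      linear_combination -(M.mulVec β 0) * a0 - M.mulVec β 1 * b0
    · change M.mulVec β 1 - (M.mulVec β 0 * M.mulVec α 1 + M.mulVec β 1 * M.mulVec α' 1) = 0
      linear_combination -(M.mulVec β 0) * a1 - M.mulVec β 1 * b1
  apply hj
  have e3 : ∑ k, β k * P.s k ((ρ : ℂ) ^ 2) 0 = P.s j ((ρ : ℂ) ^ 2) 0 := by
    simp [hβ, Pi.single_apply]
  rw [← e3, hβ']
  simp only [Pi.add_apply, Pi.smul_apply, smul_eq_mul, Fin.sum_univ_two] at e1 e2 ⊢
  linear_combination M.mulVec β 0 * e1 + M.mulVec β 1 * e2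

end SingularSL

end

theorem theorem2 (P : SingularSL) (hP : P.Admissible) :
    (∀ lam : ℝ, 0 < lam → ¬ P.IsEigenvalue (lam : ℂ)) ∧
    (∀ (lam₀ : ℝ) (ρ₀ : ℂ), (lam₀ : ℂ) = ρ₀ ^ 2 → 0 < lam₀ → P.Δ ρ₀ = 0 → P.Δ (-ρ₀) ≠ 0) := by
  refine ⟨fun lam hlam => hP.not_isEigenvalue hlam, fun lam₀ ρ₀ hsq hpos h0 => ?_⟩
  -- A complex number with positive square is real, of either sign.
  obtain ⟨ρ, hρ, rfl⟩ : ∃ ρ : ℝ, ρ ≠ 0 ∧ ρ₀ = ρ := by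
    have hs : ((Real.sqrt lam₀ : ℝ) : ℂ) ^ 2 = lam₀ := by exact_mod_cast Real.sq_sqrt hpos.le
    have hne := (Real.sqrt_pos.2 hpos).ne'
    rcases sq_eq_sq_iff_eq_or_eq_neg.1 (hsq.symm.trans hs.symm) with h | h
    · exact ⟨_, hne, h⟩
    · exact ⟨-Real.sqrt lam₀, neg_ne_zero.2 hne, by rw [h]; push_cast; rfl⟩
  exact hP.Δ_neg_ne_zero hρ h0
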